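/- Let $I=(0,1]$, and let $\rho=(\rho_\varepsilon)_{\varepsilon\in I}$ be a gauge, i.e. a non-decreasing net in $(0,1]$ with $\rho_\varepsilon\to0$ as $\varepsilon\to0^+$. A net $(x_\varepsilon)\in\mathbb R^I$ is moderate if $\exists N\in\mathbb N$: $|x_\varepsilon|\le\rho_\varepsilon^{-N}$ for $\varepsilon$ small, and negligible if $\forall n\in\mathbb N$: $|x_\varepsilon|\le\rho_\varepsilon^{n}$ for $\varepsilon$ small. Let ${}^\rho\widetilde{\mathbb R}$ be the Robinson–Colombeau ring, the quotient of the ring of moderate nets by the ideal of negligible nets; $[x_\varepsilon]$ denotes the class of $(x_\varepsilon)$, and classes in ${}^\rho\widetilde{\mathbb R}^n$ are taken componentwise. Write $x\le y$ if there are representatives with $x_\varepsilon\le y_\varepsilon$ for all $\varepsilon$, write $x<y$ if $x\le y$ and $x-y$ is invertible, and put $[a,b]=\{x\in{}^\rho\widetilde{\mathbb R}\mid a\le x\le b\}$ and $|[x_\varepsilon]|=[|x_\varepsilon|]$. The sharp topology on ${}^\rho\widetilde{\mathbb R}$ is generated by the balls $\{x\mid |x-c|<r\}$, $r>0$. For $X\subseteq{}^\rho\widetilde{\mathbb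 R}^n$, a map $f:X\to{}^\rho\widetilde{\mathbb R}$ is a generalized smooth function (GSF) if there are open sets $\Omega_\varepsilon\subseteq\mathbb R^n$ and $f_\varepsilon\in C^\infty(\Omega_\varepsilon,\mathbb R)$ such that, for every $x\in X$ and every representative $(x_\varepsilon)$ of $x$: $x_\varepsilon\in\Omega_\varepsilon$ for $\varepsilon$ small, $f(x)=[f_\varepsilon(x_\varepsilon)]$, and the net $(\partial^\alpha f_\varepsilon(x_\varepsilon))$ is moderate for every $\alpha\in\mathbb N^n$. A map into ${}^\rho\widetilde{\mathbb R}^d$ is a GSF if all its components are. The derivative of $f:X\to{}^\rho\widetilde{\mathbb R}$ at $x\in X$ along $v$ is $r(0)$, where $r$ is an incremental ratio, i.e. $f(x+hv)=f(x)+h\,r(h)$ for all sufficiently small $h\in{}^\rho\widetilde{\mathbb R}$ with $x+hv\in X$, and $r$ is continuous at $h=0$ in the sharp topology (with respect to such $h$). For a GSF $f$ on $[a,b]$, with $a<b$, and $c\in[a,b]$, $x\mapsto\int_c^x f(s)\,ds$ denotes the GSF $F$ on $[a,b]$ with $F(c)=0$ and $F'=f$. Let $m,d\in\mathbb N$ with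 $m\ge1$, let $t_1<t_2$ in ${}^\rho\widetilde{\mathbb R}$, let $L:[t_1,t_2]\times{}^\rho\widetilde{\mathbb R}^{d\times(m+1)}\to{}^\rho\widetilde{\mathbb R}$ and $q:[t_1,t_2]\to{}^\rho\widetilde{\mathbb R}^d$ be GSF. Put $L[q]^m(t)=L(t,q(t),q^{(1)}(t),\dots,q^{(m)}(t))$ and $J[q]=\int_{t_1}^{t_2}L[q]^m(t)\,dt$. For $0\le i\le m$ let $\partial_{i+2}L[q]^m(t)\in{}^\rho\widetilde{\mathbb R}^d$ be the vector of partial derivatives of $L$ with respect to the components of its variable $q^{(i)}$, at the point $(t,q(t),\dots,q^{(m)}(t))$. Suppose that $q$ is a weak extremal of $J$, i.e. $$\delta J(q;h):=\frac{d}{ds}J[q+sh]\Big|_{s=0}=0$$ for every GSF $h:[t_1,t_2]\to{}^\rho\widetilde{\mathbb R}^d$ with $h^{(i)}(t_1)=h^{(i)}(t_2)=0$ for $i=0,\dots,m-1$. Then all derivatives and iterated integrals of $q$, $L$ and $\partial_{i+2}L[q]^m$ that occur below exist, and: (a) (integral form) there are polynomials of degree at most $m-1$ with coefficients in ${}^\rho\widetilde{\mathbb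 R}$, one for each of the $d$ components, such that for all $t\in[t_1,t_2]$ the corresponding component of $$\sum_{i=0}^m(-1)^i\underbrace{\int_{t_1}^t\int_{t_1}^{s_1}\cdots\int_{t_1}^{s_{m-i-1}}}_{m-i\text{ times}}\partial_{i+2}L[q]^m(s_{m-i})\,ds_{m-i}\cdots ds_1$$ equals the value of the polynomial at $t$ (for $i=m$ the term is $(-1)^m\partial_{m+2}L[q]^m(t)$); (b) (differential form) $$\sum_{i=0}^m(-1)^i\frac{d^i}{dt^i}\,\partial_{i+2}L[q]^m(t)=0\qquad\text{for all }t\in[t_1,t_2].$$ -/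

import Mathlib

open Filter Topology
open scoped ContDiff

noncomputable section

namespace RobinsonColombeau

/-- The index set `I = (0,1]`. On this linear order `∀ᶠ ε in atBot, P ε` means
`∃ ε₀, ∀ ε ≤ ε₀, P ε`, i.e. "for `ε` small". -/
abbrev Idx : Type := {ε : ℝ // ε ∈ Set.Ioc (0 : ℝ) 1}

/-- A gauge: a non-decreasing net in `(0,1]` tending to `0` as `ε → 0⁺`. -/
structure Gauge where
  toFun : Idx → ℝ
  pos' : ∀ ε, 0 < toFun ε
  le_one' : ∀ ε, toFun ε ≤ 1
  mono' : Monotone toFun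
  tendsto_zero' : Tendsto toFun atBot (𝓝 0)

instance : CoeFun Gauge (fun _ => Idx → ℝ) := ⟨Gauge.toFun⟩

variable (ρ : Gauge)

/-- `ρ`-moderate nets: `∃ N, ∀⁰ ε, |x_ε| ≤ ρ_ε ^ (-N)`. -/
def IsModerate (x : Idx → ℝ) : Prop :=
  ∃ N : ℕ, ∀ᶠ ε in atBot, |x ε| ≤ (ρ ε ^ N)⁻¹

/-- `ρ`-negligible nets: `∀ n, ∀⁰ ε, |x_ε| ≤ ρ_ε ^ n`. -/
def IsNegligible (x : Idx → ℝ) : Prop :=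
  ∀ n : ℕ, ∀ᶠ ε in atBot, |x ε| ≤ ρ ε ^ n

lemma gauge_eventually_half : ∀ᶠ ε in atBot, ρ ε ≤ 1 / 2 :=
  (ρ.tendsto_zero'.eventually (Iio_mem_nhds (by norm_num : (0 : ℝ) < 1 / 2))).mono
    fun _ h => le_of_lt h

variable {ρ}

lemma inv_pow_le_inv_pow (ε : Idx) {N M : ℕ} (h : N ≤ M) : (ρ ε ^ N)⁻¹ ≤ (ρ ε ^ M)⁻¹ :=
  inv_anti₀ (pow_pos (ρ.pos' ε) M)
    (pow_le_pow_of_le_one (ρ.pos' ε).le (ρ.le_one' ε) h)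

lemma IsModerate.add {x y : Idx → ℝ} (hx : IsModerate ρ x) (hy : IsModerate ρ y) :
    IsModerate ρ (x + y) := by
  obtain ⟨N, hN⟩ := hx
  obtain ⟨M, hM⟩ := hy
  refine ⟨max N M + 1, ?_⟩
  filter_upwards [hN, hM, gauge_eventually_half ρ] with ε h1 h2 h3
  have hp := ρ.pos' ε
  have a1 := inv_pow_le_inv_pow (ρ := ρ) ε (le_max_left N M)
  have a2 := inv_pow_le_inv_pow (ρ := ρ) ε (le_max_right N M)
  have a3 : (0 : ℝ) < (ρ ε ^ max N M)⁻¹ := inv_pos.2 (pow_pos hp _)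
  have a4 : (2 : ℝ) ≤ (ρ ε)⁻¹ := by
    rw [le_inv_comm₀ (by norm_num) hp]; linarith
  calc |(x + y) ε| ≤ |x ε| + |y ε| := abs_add_le _ _
    _ ≤ (ρ ε ^ max N M)⁻¹ * 2 := by linarith
    _ ≤ (ρ ε ^ max N M)⁻¹ * (ρ ε)⁻¹ := mul_le_mul_of_nonneg_left a4 a3.le
    _ = (ρ ε ^ (max N M + 1))⁻¹ := by rw [pow_succ, mul_inv]

lemma IsModerate.mul {x y : Idx → ℝ} (hx : IsModerate ρ x) (hy : IsModerate ρ y) :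
    IsModerate ρ (x * y) := by
  obtain ⟨N, hN⟩ := hx
  obtain ⟨M, hM⟩ := hy
  refine ⟨N + M, ?_⟩
  filter_upwards [hN, hM] with ε h1 h2
  rw [Pi.mul_apply, abs_mul, pow_add, mul_inv]
  exact mul_le_mul h1 h2 (abs_nonneg _) (inv_nonneg.2 (pow_nonneg (ρ.pos' ε).le _))

lemma IsNegligible.add {x y : Idx → ℝ} (hx : IsNegligible ρ x) (hy : IsNegligible ρ y) :
    IsNegligible ρ (x + y) := by
  intro n
  filter_upwards [hx (n + 1), hy (n + 1), gauge_eventually_half ρ] with ε h1 h2 h3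
  have hp : (0 : ℝ) ≤ ρ ε ^ n := pow_nonneg (ρ.pos' ε).le _
  have h4 : |(x + y) ε| ≤ |x ε| + |y ε| := abs_add_le _ _
  rw [pow_succ] at h1 h2
  nlinarith

lemma IsModerate.mul_negligible {x y : Idx → ℝ} (hx : IsModerate ρ x)
    (hy : IsNegligible ρ y) : IsNegligible ρ (x * y) := by
  obtain ⟨N, hN⟩ := hx
  intro n
  filter_upwards [hN, hy (N + n)] with ε h1 h2
  have hp : (0 : ℝ) < ρ ε ^ N := pow_pos (ρ.pos' ε) _
  rw [Pi.mul_apply, abs_mul]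
  calc |x ε| * |y ε| ≤ (ρ ε ^ N)⁻¹ * ρ ε ^ (N + n) :=
        mul_le_mul h1 h2 (abs_nonneg _) (inv_nonneg.2 hp.le)
    _ = ρ ε ^ n := by rw [pow_add, ← mul_assoc, inv_mul_cancel₀ hp.ne', one_mul]

variable (ρ)

/-- The ring `ℝ_ρ` of moderate nets, with pointwise operations. -/
def Moderate : Subring (Idx → ℝ) where
  carrier := {x | IsModerate ρ x}
  mul_mem' := IsModerate.mul
  one_mem' := ⟨0, Eventually.of_forall fun ε => by simp⟩
  add_mem' := IsModerate.add
  zero_mem' := ⟨0, Eventually.of_forall fun ε => by simp⟩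
  neg_mem' := by
    rintro x ⟨N, hN⟩
    exact ⟨N, hN.mono fun ε h => by simpa using h⟩

/-- The ideal of negligible nets in `ℝ_ρ`. -/
def Negligible : Ideal (Moderate ρ) where
  carrier := {x | IsNegligible ρ x.1}
  add_mem' := IsNegligible.add
  zero_mem' := fun n => Eventually.of_forall fun ε => by
    simpa using pow_nonneg (ρ.pos' ε).le n
  smul_mem' := fun c _ hx => IsModerate.mul_negligible c.2 hx

/-- The Robinson–Colombeau ring of generalized numbers. -/
abbrev RC : Type := Moderate ρ ⧸ Negligible ρ

variable {ρ}

/-- `x = [x_ε]`: the net `(x_ε)` is moderate and its class is `x`. -/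
def Represents (u : Idx → ℝ) (x : RC ρ) : Prop :=
  ∃ hu : u ∈ Moderate ρ, Ideal.Quotient.mk (Negligible ρ) ⟨u, hu⟩ = x

/-- `x = [x_ε]` for a generalized point `x` with finitely many coordinates. -/
def RepresentsPt {ι : Type*} (u : Idx → ι → ℝ) (x : ι → RC ρ) : Prop :=
  ∀ i, Represents (fun ε => u ε i) (x i)

/-- `x ≤ y`: there are representatives with `x_ε ≤ y_ε` for all `ε`. -/
def RC.Le (x y : RC ρ) : Prop :=
  ∃ u v : Idx → ℝ, Represents u x ∧ Represents v y ∧ ∀ ε, u ε ≤ v ε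

/-- `x < y`: `x ≤ y` and `x - y` is invertible. -/
def RC.Lt (x y : RC ρ) : Prop := RC.Le x y ∧ IsUnit (x - y)

/-- The interval `[a,b] = {x | a ≤ x ≤ b}` of generalized numbers. -/
def RC.interval (a b : RC ρ) : Set (RC ρ) := {x | RC.Le a x ∧ RC.Le x b}

lemma abs_mem_moderate {u : Idx → ℝ} (hu : u ∈ Moderate ρ) :
    (fun ε => |u ε|) ∈ Moderate ρ := by
  obtain ⟨N, hN⟩ := hu
  exact ⟨N, hN.mono fun ε h => by simpa using h⟩

/-- `|[x_ε]| = [|x_ε|]`. -/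
def RC.abs (x : RC ρ) : RC ρ :=
  Quotient.liftOn' x
    (fun u => Ideal.Quotient.mk (Negligible ρ) ⟨fun ε => |u.1 ε|, abs_mem_moderate u.2⟩)
    (by
      intro u v h
      rw [Submodule.quotientRel_def] at h
      refine Ideal.Quotient.eq.2 fun n => (h n).mono fun ε hε => ?_
      exact le_trans (abs_abs_sub_abs_le (u.1 ε) (v.1 ε)) hε)

/-- The strongly internal set `⟨Ω_ε⟩` in `RC^ι`: the points all of whose representatives
belong to `Ω_ε` for `ε` small. -/
def stronglyInternal {ι : Type*} (Ω : Idx → Set (ι → ℝ)) : Set (ι → RC ρ) :=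
  {x | ∀ u : Idx → ι → ℝ, RepresentsPt u x → ∀ᶠ ε in atBot, u ε ∈ Ω ε}

/-- `f : X → RC` is a generalized smooth function on `X ⊆ RC^ι` (only the values of `f` on `X`
matter): it is defined by a net of smooth functions `f_ε` on open sets `Ω_ε` with
`X ⊆ ⟨Ω_ε⟩`, such that `f [x_ε] = [f_ε x_ε]` and all partial derivatives of the `f_ε` are
moderate along every representative of every point of `X`. The partial derivatives of order `k`
are moderate if and only if the norms of the `k`-th Fréchet derivatives are. -/
def IsGSF {ι : Type*} [Fintype ι] (X : Set (ι → RC ρ)) (f : (ι → RC ρ) → RC ρ) : Prop :=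
  ∃ (Ω : Idx → Set (ι → ℝ)) (F : Idx → (ι → ℝ) → ℝ),
    (∀ ε, IsOpen (Ω ε)) ∧
    (∀ ε, ContDiffOn ℝ ∞ (F ε) (Ω ε)) ∧
    X ⊆ stronglyInternal Ω ∧
    ∀ x ∈ X, ∀ u : Idx → ι → ℝ, RepresentsPt u x →
      Represents (fun ε => F ε (u ε)) (f x) ∧
      ∀ k : ℕ, IsModerate ρ (fun ε => ‖iteratedFDeriv ℝ k (F ε) (u ε)‖)

/-- Generalized smooth functions of one variable (`RC` is identified with `RC^1`). -/
def IsGSF₁ (X : Set (RC ρ)) (f : RC ρ → RC ρ) : Prop :=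
  IsGSF (ι := Unit) {x | x () ∈ X} (fun x => f (x ()))

/-- `y = ∂f/∂v (x)` for `f : X → RC`: there is an incremental ratio `r` at `x` along `v`, i.e.
`f (x + h v) = f x + h * r h` for all small `h` with `x + h v ∈ X`, which is continuous at
`h = 0` in the sharp topology and satisfies `r 0 = y`. -/
def HasDirDeriv {M : Type*} [AddCommGroup M] [Module (RC ρ) M]
    (X : Set M) (f : M → RC ρ) (x v : M) (y : RC ρ) : Prop :=
  ∃ r : RC ρ → RC ρ, r 0 = y ∧
    (∃ δ : RC ρ, RC.Lt 0 δ ∧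
      ∀ h, RC.Lt (RC.abs h) δ → x + h • v ∈ X → f (x + h • v) = f x + h * r h) ∧
    ∀ η : RC ρ, RC.Lt 0 η → ∃ δ : RC ρ, RC.Lt 0 δ ∧
      ∀ h, RC.Lt (RC.abs h) δ → x + h • v ∈ X → RC.Lt (RC.abs (r h - y)) η

open Classical in
/-- The directional derivative `∂f/∂v (x)` of `f : X → RC`. -/
def dirDeriv {M : Type*} [AddCommGroup M] [Module (RC ρ) M]
    (X : Set M) (f : M → RC ρ) (v x : M) : RC ρ :=
  if h : ∃ y, HasDirDeriv X f x v y then h.choose else 0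

/-- The `n`-th derivative of a function `f : X → RC` of one variable. -/
def iterDeriv (X : Set (RC ρ)) (n : ℕ) (f : RC ρ → RC ρ) : RC ρ → RC ρ :=
  (fun g => dirDeriv X g 1)^[n] f

/-- `F` is the primitive of `f` on `[a,b]` that vanishes at `c`. -/
def IsPrimitive (a b c : RC ρ) (f F : RC ρ → RC ρ) : Prop :=
  IsGSF₁ (RC.interval a b) F ∧ F c = 0 ∧
    ∀ x ∈ RC.interval a b, HasDirDeriv (RC.interval a b) F x 1 (f x)

open Classical in
/-- `∫_c^x f`, as a function of `x ∈ [a,b]`. -/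
def primitive (a b c : RC ρ) (f : RC ρ → RC ρ) : RC ρ → RC ρ :=
  if h : ∃ F, IsPrimitive a b c f F then h.choose else 0

/-- The `n`-fold iterated integral `∫_a^t ∫_a^{s₁} ⋯ ∫_a^{s_{n-1}} f(s_n) ds_n ⋯ ds₁`,
as a function of `t ∈ [a,b]`. -/
def iterInt (a b : RC ρ) (n : ℕ) (f : RC ρ → RC ρ) : RC ρ → RC ρ :=
  (fun g => primitive a b a g)^[n] f

/-! The variational problem. The variables of a Lagrangian of order `m` in `d` unknowns are
indexed by `Option (Fin (m + 1) × Fin d)`: `none` is the time, and `some (i, k)` is the `k`-th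
component of the `i`-th derivative. -/

/-- The point `[q]^m (t) = (t, q(t), q'(t), …, q^(m)(t))`. -/
def jet {d : ℕ} (m : ℕ) (t₁ t₂ : RC ρ) (q : RC ρ → Fin d → RC ρ) (t : RC ρ) :
    Option (Fin (m + 1) × Fin d) → RC ρ
  | none => t
  | some (i, k) => iterDeriv (RC.interval t₁ t₂) i (fun s => q s k) t

/-- The domain `[t₁,t₂] × RC^{d × (m+1)}` of the Lagrangian. -/
def lagrangianDomain (d m : ℕ) (t₁ t₂ : RC ρ) :
    Set (Option (Fin (m + 1) × Fin d) → RC ρ) :=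
  {x | x none ∈ RC.interval t₁ t₂}

/-- `J[q] = ∫_{t₁}^{t₂} L(t, q(t), …, q^(m)(t)) dt`. -/
def action {d m : ℕ} (t₁ t₂ : RC ρ) (L : (Option (Fin (m + 1) × Fin d) → RC ρ) → RC ρ)
    (q : RC ρ → Fin d → RC ρ) : RC ρ :=
  primitive t₁ t₂ t₁ (fun t => L (jet m t₁ t₂ q t)) t₂

/-- Generalized smooth curves `[t₁,t₂] → RC^d`. -/
def IsGSFCurve {d : ℕ} (t₁ t₂ : RC ρ) (q : RC ρ → Fin d → RC ρ) : Prop :=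
  ∀ k, IsGSF₁ (RC.interval t₁ t₂) (fun t => q t k)

/-- Generalized smooth curves whose derivatives of order `0, …, m - 1` vanish at `t₁`, `t₂`. -/
def IsVariation {d : ℕ} (m : ℕ) (t₁ t₂ : RC ρ) (h : RC ρ → Fin d → RC ρ) : Prop :=
  IsGSFCurve t₁ t₂ h ∧ ∀ i < m, ∀ k,
    iterDeriv (RC.interval t₁ t₂) i (fun t => h t k) t₁ = 0 ∧
    iterDeriv (RC.interval t₁ t₂) i (fun t => h t k) t₂ = 0

/-- The first variation `δJ(q;h) = d/ds J[q + s h] |_{s = 0}`. -/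
def firstVariation {d m : ℕ} (t₁ t₂ : RC ρ)
    (L : (Option (Fin (m + 1) × Fin d) → RC ρ) → RC ρ) (q h : RC ρ → Fin d → RC ρ) : RC ρ :=
  dirDeriv Set.univ (fun s : RC ρ => action t₁ t₂ L (fun t k => q t k + s * h t k)) 1 0

/-- `q` is a weak extremal of `J`. -/
def IsWeakExtremal {d m : ℕ} (t₁ t₂ : RC ρ)
    (L : (Option (Fin (m + 1) × Fin d) → RC ρ) → RC ρ) (q : RC ρ → Fin d → RC ρ) : Prop :=
  IsGSFCurve t₁ t₂ q ∧
    ∀ h : RC ρ → Fin d → RC ρ, IsVariation m t₁ t₂ h → firstVariation t₁ t₂ L q h = 0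

/-- `∂_{i+2} L [q]^m (t)`, `k`-th component: the partial derivative of `L` with respect to the
`k`-th component of the variable `q^(i)`, at the point `[q]^m (t)`. -/
def partialL {d m : ℕ} (t₁ t₂ : RC ρ)
    (L : (Option (Fin (m + 1) × Fin d) → RC ρ) → RC ρ) (q : RC ρ → Fin d → RC ρ)
    (i : Fin (m + 1)) (k : Fin d) (t : RC ρ) : RC ρ :=
  dirDeriv (lagrangianDomain d m t₁ t₂) L (Pi.single (some (i, k)) 1) (jet m t₁ t₂ q t)

end RobinsonColombeau

end

open RobinsonColombeau

/-!
The Euler–Lagrange equations of a higher order variational problem over the Robinson–Colombeau ring.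

Two principles transfer classical analysis from nets to generalized numbers. First, uniformity
comes for free: a bound that holds along every net of points of a family of sets holds, with one
power of the gauge, on the whole sets (`exists_uniform_bound_of_nets`), because a net may be chosen
to pick the worst points. Applied to boxes of points whose distinguished coordinate lies in
`[a_ε, b_ε]`, this bounds all derivatives of a defining net and yields a second order Taylor
estimate (`HasNet.exists_taylor`). Second, such a quadratic estimate is divisible by the increment
and produces an incremental ratio (`HasDirDeriv.of_quadratic`), while ratios are unique since there
are arbitrarily small invertible increments. Hence derivatives are computed on nets, which gives the
sum and product rules. A mean value inequality (`IsGSF₁.mul_sub_le`) gives the uniqueness of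
primitives, their monotonicity and their bounds, and a primitive exists by integrating a net over
the components of its domains (`IsGSF₁.exists_isPrimitive`).

The Taylor estimate of the Lagrangian, uniform in time, shows that the first variation is the
integral of `∑ ∂L · h^(i)` (`HasNet.firstVariation_eq`). Integration by parts turns it into the
integral of `E h`, where `E` is the Euler–Lagrange expression of one component. The fundamental
lemma then needs no bump functions: `h = ((t - t₁) (t₂ - t)) ^ m E` is itself an admissible
variation, and it makes the integrand `E h` nonnegative. The primitive of `E h` increases from `0`
to `0`, so its derivative `E h` vanishes; as the ring is reduced, `E` vanishes at all points whose
distances to both end points are invertible, and by continuity everywhere. This is the differential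
form. The expression in the integral form has `E = 0` as its derivative of order `m`, hence it is a
polynomial of degree less than `m` (`IsGSF₁.exists_polynomial`).
-/

namespace RobinsonColombeau

variable {ρ : Gauge}

/-! ### Nets and their classes -/

lemma Gauge.pow_pos (ρ : Gauge) (n : ℕ) (ε : Idx) : 0 < ρ ε ^ n := _root_.pow_pos (ρ.pos' ε) n

lemma Gauge.pow_anti (ρ : Gauge) {m n : ℕ} (h : m ≤ n) (ε : Idx) : ρ ε ^ n ≤ ρ ε ^ m :=
  pow_le_pow_of_le_one (ρ.pos' ε).le (ρ.le_one' ε) h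

/-- A fixed factor is absorbed by one extra power of the gauge. -/
lemma Gauge.eventually_mul_pow_succ_le (ρ : Gauge) (C : ℝ) (n : ℕ) :
    ∀ᶠ ε in atBot, C * ρ ε ^ (n + 1) ≤ ρ ε ^ n := by
  have h : ∀ᶠ ε in atBot, ρ ε < (|C| + 1)⁻¹ :=
    ρ.tendsto_zero'.eventually (Iio_mem_nhds (by positivity))
  filter_upwards [h] with ε hε
  have hp := ρ.pow_pos n ε
  have h0 := ρ.pos' ε
  have h1 : (|C| + 1) * ρ ε ≤ 1 := by
    have := mul_le_mul_of_nonneg_left hε.le (by positivity : 0 ≤ |C| + 1)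
    rwa [mul_inv_cancel₀ (by positivity)] at this
  have h2 : C * ρ ε ≤ 1 := by
    have := le_abs_self C
    nlinarith
  calc C * ρ ε ^ (n + 1) = (C * ρ ε) * ρ ε ^ n := by ring
    _ ≤ 1 * ρ ε ^ n := mul_le_mul_of_nonneg_right h2 hp.le
    _ = ρ ε ^ n := one_mul _

lemma Gauge.eventually_le_inv (ρ : Gauge) (C : ℝ) :
    ∀ᶠ ε in atBot, C ≤ (ρ ε ^ 1)⁻¹ := by
  filter_upwards [ρ.eventually_mul_pow_succ_le C 0] with ε h
  rw [← one_div, le_div_iff₀ (ρ.pow_pos 1 ε)]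
  simpa using h

lemma Gauge.one_le_inv (ρ : Gauge) (n : ℕ) (ε : Idx) : 1 ≤ (ρ ε ^ n)⁻¹ :=
  (one_le_inv₀ (ρ.pow_pos n ε)).2 (pow_le_one₀ (ρ.pos' ε).le (ρ.le_one' ε))

lemma IsModerate.of_le {u v : Idx → ℝ} (hv : IsModerate ρ v)
    (h : ∀ᶠ ε in atBot, |u ε| ≤ |v ε|) : IsModerate ρ u := by
  obtain ⟨N, hN⟩ := hv
  exact ⟨N, by filter_upwards [hN, h] with ε h1 h2 using h2.trans h1⟩

lemma isModerate_const (c : ℝ) : IsModerate ρ fun _ => c :=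
  ⟨1, ρ.eventually_le_inv |c|⟩

lemma isModerate_inv_pow (n : ℕ) : IsModerate ρ fun ε => (ρ ε ^ n)⁻¹ :=
  ⟨n, Eventually.of_forall fun ε => by
    rw [abs_of_nonneg (inv_nonneg.2 (ρ.pow_pos n ε).le)]⟩

lemma isModerate_pow (n : ℕ) : IsModerate ρ fun ε => ρ ε ^ n :=
  (isModerate_const 1).of_le <| Eventually.of_forall fun ε => by
    rw [abs_of_nonneg (ρ.pow_pos n ε).le, abs_one]
    exact pow_le_one₀ (ρ.pos' ε).le (ρ.le_one' ε)

lemma IsModerate.neg {u : Idx → ℝ} (hu : IsModerate ρ u) : IsModerate ρ fun ε => -u ε :=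
  hu.of_le <| Eventually.of_forall fun ε => by simp

lemma IsModerate.sub {u v : Idx → ℝ} (hu : IsModerate ρ u) (hv : IsModerate ρ v) :
    IsModerate ρ fun ε => u ε - v ε := by
  simpa [sub_eq_add_neg, Pi.add_def] using hu.add hv.neg

lemma IsModerate.sum {ι : Type*} (s : Finset ι) {u : ι → Idx → ℝ}
    (h : ∀ i ∈ s, IsModerate ρ (u i)) : IsModerate ρ fun ε => ∑ i ∈ s, u i ε := by
  have := (Moderate ρ).sum_mem (t := s) (f := u) h
  have h2 : (fun ε => ∑ i ∈ s, u i ε) = ∑ i ∈ s, u i := by ext ε; simp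
  rw [h2]; exact this

lemma IsModerate.pow {u : Idx → ℝ} (h : IsModerate ρ u) (n : ℕ) :
    IsModerate ρ fun ε => u ε ^ n := (Moderate ρ).pow_mem h n

lemma IsModerate.abs {u : Idx → ℝ} (h : IsModerate ρ u) :
    IsModerate ρ fun ε => |u ε| := abs_mem_moderate h

lemma IsNegligible.of_le {u v : Idx → ℝ} (hv : IsNegligible ρ v)
    (h : ∀ᶠ ε in atBot, |u ε| ≤ |v ε|) : IsNegligible ρ u := fun n => by
  filter_upwards [hv n, h] with ε h1 h2 using h2.trans h1

lemma IsNegligible.isModerate {u : Idx → ℝ} (hu : IsNegligible ρ u) : IsModerate ρ u :=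
  ⟨0, by simpa using hu 0⟩

lemma IsNegligible.sum {ι : Type*} (s : Finset ι) {u : ι → Idx → ℝ}
    (h : ∀ i ∈ s, IsNegligible ρ (u i)) : IsNegligible ρ fun ε => ∑ i ∈ s, u i ε := by
  classical
  induction s using Finset.induction_on with
  | empty => intro n; exact Eventually.of_forall fun ε => by simpa using (ρ.pow_pos n ε).le
  | insert a s ha ih =>
    have := (h a (by simp)).add (ih fun i hi => h i (by simp [hi]))
    simpa [Finset.sum_insert ha, Pi.add_def] using this

lemma isNegligible_norm {ι : Type*} [Fintype ι] {u : Idx → ι → ℝ}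
    (h : ∀ i, IsNegligible ρ fun ε => u ε i) : IsNegligible ρ fun ε => ‖u ε‖ := by
  refine (IsNegligible.sum Finset.univ (u := fun i ε => |u ε i|) fun i _ =>
    (h i).of_le (Eventually.of_forall fun ε => by simp)).of_le
    (Eventually.of_forall fun ε => ?_)
  rw [abs_of_nonneg (norm_nonneg _), abs_of_nonneg (Finset.sum_nonneg fun i _ => abs_nonneg _)]
  exact (pi_norm_le_iff_of_nonneg (Finset.sum_nonneg fun i _ => abs_nonneg _)).2 fun i =>
    Finset.single_le_sum (f := fun i => |u ε i|) (fun i _ => abs_nonneg _) (Finset.mem_univ i)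

/-! ### Representatives -/

lemma exists_represents (x : RC ρ) : ∃ u, Represents u x := by
  obtain ⟨u, rfl⟩ := Ideal.Quotient.mk_surjective x
  exact ⟨u.1, u.2, rfl⟩

lemma IsModerate.exists_represents {u : Idx → ℝ} (h : IsModerate ρ u) :
    ∃ x : RC ρ, Represents u x := ⟨_, h, rfl⟩

namespace Represents

variable {u v : Idx → ℝ} {x y : RC ρ}

lemma isModerate (h : Represents u x) : IsModerate ρ u := h.1

lemma isNegligible_sub (hu : Represents u x) (hv : Represents v x) :
    IsNegligible ρ fun ε => u ε - v ε := by
  obtain ⟨hu, rfl⟩ := hu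
  obtain ⟨hv, h⟩ := hv
  exact Ideal.Quotient.eq.1 h.symm

lemma eq_of_isNegligible_sub (hu : Represents u x) (hv : Represents v y)
    (h : IsNegligible ρ fun ε => u ε - v ε) : x = y := by
  obtain ⟨hu, rfl⟩ := hu
  obtain ⟨hv, rfl⟩ := hv
  exact Ideal.Quotient.eq.2 h

lemma unique (hu : Represents u x) (hv : Represents u y) : x = y := by
  obtain ⟨_, rfl⟩ := hu
  obtain ⟨_, rfl⟩ := hv
  rfl

lemma of_isNegligible_sub (hu : Represents u x) (h : IsNegligible ρ fun ε => v ε - u ε) :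
    Represents v x := by
  have hv : IsModerate ρ v := by
    simpa [Pi.add_def] using hu.isModerate.add h.isModerate
  obtain ⟨y, hy⟩ := hv.exists_represents
  rwa [← hy.eq_of_isNegligible_sub hu h]

lemma congr (hu : Represents u x) (h : ∀ᶠ ε in atBot, v ε = u ε) : Represents v x :=
  hu.of_isNegligible_sub fun n => by
    filter_upwards [h] with ε hε
    simpa [hε] using (ρ.pow_pos n ε).le

lemma add (hu : Represents u x) (hv : Represents v y) :
    Represents (fun ε => u ε + v ε) (x + y) := by
  obtain ⟨hu, rfl⟩ := hu
  obtain ⟨hv, rfl⟩ := hv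
  exact ⟨(Moderate ρ).add_mem hu hv, rfl⟩

lemma mul (hu : Represents u x) (hv : Represents v y) :
    Represents (fun ε => u ε * v ε) (x * y) := by
  obtain ⟨hu, rfl⟩ := hu
  obtain ⟨hv, rfl⟩ := hv
  exact ⟨(Moderate ρ).mul_mem hu hv, rfl⟩

lemma neg (hu : Represents u x) : Represents (fun ε => -u ε) (-x) := by
  obtain ⟨hu, rfl⟩ := hu
  exact ⟨(Moderate ρ).neg_mem hu, rfl⟩

lemma sub (hu : Represents u x) (hv : Represents v y) :
    Represents (fun ε => u ε - v ε) (x - y) := by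
  simpa [sub_eq_add_neg] using hu.add hv.neg

lemma zero : Represents (fun _ => 0) (0 : RC ρ) := ⟨(Moderate ρ).zero_mem, rfl⟩

lemma one : Represents (fun _ => 1) (1 : RC ρ) := ⟨(Moderate ρ).one_mem, rfl⟩

lemma abs (hu : Represents u x) : Represents (fun ε => |u ε|) (RC.abs x) := by
  obtain ⟨hu, rfl⟩ := hu
  exact ⟨abs_mem_moderate hu, rfl⟩

lemma sum {ι : Type*} (s : Finset ι) {u : ι → Idx → ℝ} {x : ι → RC ρ}
    (h : ∀ i ∈ s, Represents (u i) (x i)) :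
    Represents (fun ε => ∑ i ∈ s, u i ε) (∑ i ∈ s, x i) := by
  classical
  induction s using Finset.induction_on with
  | empty => simpa using zero
  | insert a s ha ih =>
    simpa [Finset.sum_insert ha] using (h a (by simp)).add (ih fun i hi => h i (by simp [hi]))

lemma eq_zero_iff (hu : Represents u x) : x = 0 ↔ IsNegligible ρ u :=
  ⟨fun h => by subst h; simpa using hu.isNegligible_sub zero,
    fun h => hu.eq_of_isNegligible_sub zero (by simpa using h)⟩

end Represents

/-! ### The order of the Robinson–Colombeau ring -/

section Order

variable {u v : Idx → ℝ} {x y z : RC ρ}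

lemma RC.le_iff (hu : Represents u x) (hv : Represents v y) :
    RC.Le x y ↔ ∀ n : ℕ, ∀ᶠ ε in atBot, u ε ≤ v ε + ρ ε ^ n := by
  constructor
  · rintro ⟨u', v', hu', hv', h⟩ n
    filter_upwards [hu.isNegligible_sub hu' (n + 1), hv'.isNegligible_sub hv (n + 1),
      ρ.eventually_mul_pow_succ_le 2 n] with ε h1 h2 h3
    have := h ε
    have := abs_le.1 h1
    have := abs_le.1 h2
    linarith
  · intro h
    refine ⟨fun ε => min (u ε) (v ε), v, hu.of_isNegligible_sub fun n => ?_, hv,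
      fun ε => min_le_right _ _⟩
    filter_upwards [h n] with ε hε
    have := ρ.pow_pos n ε
    rcases min_cases (u ε) (v ε) with h1 | h1 <;> rw [h1.1, abs_le] <;> constructor <;> linarith

lemma RC.le_of_eventually_le (hu : Represents u x) (hv : Represents v y)
    (h : ∀ᶠ ε in atBot, u ε ≤ v ε) : RC.Le x y :=
  (RC.le_iff hu hv).2 fun n => h.mono fun ε hε => hε.trans (by simpa using (ρ.pow_pos n ε).le)

lemma RC.isUnit_iff (hu : Represents u x) :
    IsUnit x ↔ ∃ N : ℕ, ∀ᶠ ε in atBot, ρ ε ^ N ≤ |u ε| := by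
  constructor
  · intro h
    obtain ⟨y, hy⟩ := h.exists_right_inv
    obtain ⟨v, hv⟩ := exists_represents y
    obtain ⟨N, hN⟩ := hv.isModerate
    have h1 := (hu.mul hv).isNegligible_sub (hy ▸ Represents.one) 1
    refine ⟨N + 1, ?_⟩
    filter_upwards [h1, hN, gauge_eventually_half ρ, ρ.eventually_mul_pow_succ_le 2 N]
      with ε h1 h2 h3 h4
    have h5 : 1 / 2 ≤ |u ε| * |v ε| := by
      rw [← abs_mul]
      have := abs_le.1 h1
      have := le_abs_self (u ε * v ε)
      simp only [pow_one] at *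
      linarith
    have hp := ρ.pow_pos N ε
    have h6 : |u ε| * |v ε| ≤ |u ε| * (ρ ε ^ N)⁻¹ :=
      mul_le_mul_of_nonneg_left h2 (abs_nonneg _)
    have h7 : 1 / 2 * ρ ε ^ N ≤ |u ε| := by
      rw [← le_div_iff₀ hp, div_eq_mul_inv]; exact h5.trans h6
    linarith
  · rintro ⟨N, hN⟩
    have hm : IsModerate ρ fun ε => (u ε)⁻¹ :=
      ⟨N, hN.mono fun ε h => by
        rw [abs_inv]; exact inv_anti₀ (ρ.pow_pos N ε) h⟩
    obtain ⟨y, hy⟩ := hm.exists_represents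
    have h1 : x * y = 1 := (hu.mul hy).unique <| Represents.one.congr <| hN.mono fun ε h => by
      have : u ε ≠ 0 := fun h0 => by
        have := ρ.pow_pos N ε
        rw [h0, abs_zero] at h
        linarith
      exact mul_inv_cancel₀ this
    exact IsUnit.of_mul_eq_one y h1

lemma RC.lt_iff (hu : Represents u x) (hv : Represents v y) :
    RC.Lt x y ↔ ∃ N : ℕ, ∀ᶠ ε in atBot, u ε + ρ ε ^ N ≤ v ε := by
  rw [RC.Lt, RC.le_iff hu hv, RC.isUnit_iff (hu.sub hv)]
  constructor
  · rintro ⟨h1, N, h2⟩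
    refine ⟨N, ?_⟩
    filter_upwards [h1 (N + 1), h2, ρ.eventually_mul_pow_succ_le 2 N] with ε h1 h2 h3
    have := ρ.pow_pos (N + 1) ε
    rcases le_abs.1 h2 with h | h <;> linarith
  · rintro ⟨N, hN⟩
    refine ⟨fun n => hN.mono fun ε h => ?_, N, hN.mono fun ε h => ?_⟩
    · have := ρ.pow_pos N ε
      have := ρ.pow_pos n ε
      linarith
    · rw [abs_sub_comm]
      exact le_trans (by linarith) (le_abs_self _)

lemma RC.le_refl (x : RC ρ) : RC.Le x x := by
  obtain ⟨u, hu⟩ := exists_represents x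
  exact ⟨u, u, hu, hu, fun _ => le_rfl⟩

lemma RC.le_antisymm (h1 : RC.Le x y) (h2 : RC.Le y x) : x = y := by
  obtain ⟨u, hu⟩ := exists_represents x
  obtain ⟨v, hv⟩ := exists_represents y
  refine hu.eq_of_isNegligible_sub hv fun n => ?_
  filter_upwards [(RC.le_iff hu hv).1 h1 n, (RC.le_iff hv hu).1 h2 n] with ε h3 h4
  rw [abs_le]; constructor <;> linarith

/-- The class of `ρ_ε ^ n`. -/
def RC.gaugePow (ρ : Gauge) (n : ℕ) : RC ρ :=
  Ideal.Quotient.mk (Negligible ρ) ⟨fun ε => ρ ε ^ n, isModerate_pow n⟩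

lemma RC.represents_gaugePow (n : ℕ) : Represents (fun ε => ρ ε ^ n) (RC.gaugePow ρ n) :=
  ⟨isModerate_pow n, rfl⟩

lemma RC.gaugePow_pos (n : ℕ) : RC.Lt 0 (RC.gaugePow ρ n) :=
  (RC.lt_iff Represents.zero (RC.represents_gaugePow n)).2
    ⟨n, Eventually.of_forall fun ε => by simp⟩

end Order

/-! ### Uniformity by choice of nets -/

/-- A property that holds eventually along every net with values in `S ε` holds, for `ε` small,
on the whole of `S ε`. -/
lemma eventually_forall_mem_of_nets {α : Type*} {S : Idx → Set α} (hS : ∀ ε, (S ε).Nonempty)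
    {P : Idx → α → Prop}
    (h : ∀ u : Idx → α, (∀ ε, u ε ∈ S ε) → ∀ᶠ ε in atBot, P ε (u ε)) :
    ∀ᶠ ε in atBot, ∀ a ∈ S ε, P ε a := by
  have hu : ∀ ε, ∃ a ∈ S ε, P ε a → ∀ b ∈ S ε, P ε b := by
    intro ε
    by_cases hP : ∀ b ∈ S ε, P ε b
    · obtain ⟨a, ha⟩ := hS ε
      exact ⟨a, ha, fun _ => hP⟩
    · push Not at hP
      obtain ⟨a, ha, hPa⟩ := hP
      exact ⟨a, ha, fun h => absurd h hPa⟩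
  choose u huS huP using hu
  exact (h u huS).mono fun ε hε => huP ε hε

/-- If `g` is moderate along every net with values in `S ε`, then a single power of the gauge
bounds `g` on the whole of `S ε`. -/
lemma exists_uniform_bound_of_nets {α : Type*} {S : Idx → Set α} (hS : ∀ ε, (S ε).Nonempty)
    {g : Idx → α → ℝ}
    (h : ∀ u : Idx → α, (∀ ε, u ε ∈ S ε) → IsModerate ρ fun ε => g ε (u ε)) :
    ∃ N : ℕ, ∀ᶠ ε in atBot, ∀ a ∈ S ε, |g ε a| ≤ (ρ ε ^ N)⁻¹ := by
  classical
  -- The net `u` realizes the largest exponent `n ε`, among those up to `1 / ε`, that is exceeded.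
  let P : Idx → ℕ → Prop := fun ε n => ∃ a ∈ S ε, (ρ ε ^ n)⁻¹ < |g ε a|
  let n : Idx → ℕ := fun ε => Nat.findGreatest (P ε) ⌈1 / (ε : ℝ)⌉₊
  have hu : ∀ ε, ∃ a ∈ S ε, P ε (n ε) → (ρ ε ^ n ε)⁻¹ < |g ε a| := by
    intro ε
    by_cases hP : P ε (n ε)
    · obtain ⟨a, ha, h⟩ := hP
      exact ⟨a, ha, fun _ => h⟩
    · obtain ⟨a, ha⟩ := hS ε
      exact ⟨a, ha, fun h => absurd h hP⟩
  choose u huS huP using hu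
  obtain ⟨N, hN⟩ := h u huS
  have hlarge : ∀ᶠ ε : Idx in atBot, N ≤ ⌈1 / (ε : ℝ)⌉₊ := by
    have h1 : (0 : ℝ) < 1 / ((N : ℝ) + 1) := by positivity
    have h2 : 1 / ((N : ℝ) + 1) ≤ 1 := by
      rw [div_le_one (by positivity)]; linarith [Nat.cast_nonneg (α := ℝ) N]
    filter_upwards [eventually_le_atBot (⟨1 / ((N : ℝ) + 1), h1, h2⟩ : Idx)] with ε hε
    have h3 : (ε : ℝ) ≤ 1 / ((N : ℝ) + 1) := hε
    have h4 : (N : ℝ) + 1 ≤ 1 / (ε : ℝ) := by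
      rw [le_div_iff₀ ε.2.1]
      rw [le_div_iff₀ (by positivity)] at h3
      linarith
    have h5 : (N : ℝ) ≤ ⌈1 / (ε : ℝ)⌉₊ := by linarith [Nat.le_ceil (1 / (ε : ℝ))]
    exact_mod_cast h5
  refine ⟨N, ?_⟩
  filter_upwards [hN, hlarge] with ε h1 h2 a ha
  by_contra hcon
  have hP : P ε N := ⟨a, ha, not_le.1 hcon⟩
  have h3 : N ≤ n ε := Nat.le_findGreatest h2 hP
  have h4 := huP ε (Nat.findGreatest_spec (P := P ε) h2 hP)
  have h5 := inv_pow_le_inv_pow (ρ := ρ) ε h3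
  linarith

/-! ### Incremental ratios -/

section DirDeriv

variable {M : Type*} [AddCommGroup M] [Module (RC ρ) M] {X : Set M} {f g : M → RC ρ}
  {x v : M} {y y' : RC ρ}

lemma RC.exists_lt_of_lt_gaugePow {δ : RC ρ} (hδ : RC.Lt 0 δ) :
    ∃ N : ℕ, ∀ n, N ≤ n → ∀ z, RC.Lt z (RC.gaugePow ρ n) → RC.Lt z δ := by
  obtain ⟨d, hd⟩ := exists_represents δ
  obtain ⟨N, hN⟩ := (RC.lt_iff Represents.zero hd).1 hδ
  refine ⟨N, fun n hn z hz => ?_⟩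
  obtain ⟨w, hw⟩ := exists_represents z
  obtain ⟨K, hK⟩ := (RC.lt_iff hw (RC.represents_gaugePow n)).1 hz
  refine (RC.lt_iff hw hd).2 ⟨K, ?_⟩
  filter_upwards [hN, hK] with ε h1 h2
  have := ρ.pow_anti hn ε
  linarith

/-- Division of a quantity of order `h²` by `h`. The representative of `D` has to be truncated
first, since an inequality between generalized numbers carries a negligible error. -/
lemma RC.exists_eq_mul_of_abs_le {D C h : RC ρ} (hD : RC.Le (RC.abs D) (C * (h * h))) :
    ∃ w, D = h * w ∧ RC.Le (RC.abs w) (RC.abs C * RC.abs h) := by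
  obtain ⟨d, hd⟩ := exists_represents D
  obtain ⟨c, hc⟩ := exists_represents C
  obtain ⟨s, hs⟩ := exists_represents h
  have hle := (RC.le_iff hd.abs (hc.mul (hs.mul hs))).1 hD
  let d' : Idx → ℝ := fun ε => max (-(|c ε| * s ε ^ 2)) (min (d ε) (|c ε| * s ε ^ 2))
  have hd'b : ∀ ε, |d' ε| ≤ |c ε| * s ε ^ 2 := fun ε => by
    have h0 : 0 ≤ |c ε| * s ε ^ 2 := by positivity
    exact abs_le.2 ⟨le_max_left _ _, max_le (by linarith) (min_le_right _ _)⟩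
  have hd' : Represents d' D := hd.of_isNegligible_sub fun n => by
    filter_upwards [hle n] with ε hε
    have h0 : 0 ≤ |c ε| * s ε ^ 2 := by positivity
    have h1 : |d ε| ≤ |c ε| * s ε ^ 2 + ρ ε ^ n := by
      have : c ε * (s ε * s ε) ≤ |c ε| * s ε ^ 2 := by
        rw [pow_two]; exact mul_le_mul_of_nonneg_right (le_abs_self _) (mul_self_nonneg _)
      linarith
    have h2 := abs_le.1 h1
    have h3 := ρ.pow_pos n ε
    rw [abs_le]
    simp only [d']
    rcases max_cases (-(|c ε| * s ε ^ 2)) (min (d ε) (|c ε| * s ε ^ 2)) with h | h <;>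
    rcases min_cases (d ε) (|c ε| * s ε ^ 2) with h' | h' <;> constructor <;> linarith
  have hwb : ∀ ε, |d' ε / s ε| ≤ |c ε| * |s ε| := fun ε => by
    rcases eq_or_ne (s ε) 0 with h0 | h0
    · simp [h0]
    · rw [abs_div, div_le_iff₀ (abs_pos.2 h0), mul_assoc, ← pow_two, sq_abs]
      exact hd'b ε
  have hwm : IsModerate ρ fun ε => d' ε / s ε :=
    (hc.mul hs).isModerate.of_le <| Eventually.of_forall fun ε => by
      rw [abs_mul]; exact hwb ε
  obtain ⟨w, hw⟩ := hwm.exists_represents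
  refine ⟨w, hd'.unique ((hs.mul hw).congr <| Eventually.of_forall fun ε => ?_),
    RC.le_of_eventually_le hw.abs (hc.abs.mul hs.abs) (Eventually.of_forall hwb)⟩
  rcases eq_or_ne (s ε) 0 with h0 | h0
  · have := hd'b ε
    rw [h0] at this ⊢
    simpa using this
  · field_simp

/-- A second order Taylor estimate yields an incremental ratio. -/
lemma HasDirDeriv.of_quadratic {C δ : RC ρ} (hδ : RC.Lt 0 δ)
    (hq : ∀ h, RC.Lt (RC.abs h) δ → x + h • v ∈ X →
      RC.Le (RC.abs (f (x + h • v) - f x - h * y)) (C * (h * h))) :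
    HasDirDeriv X f x v y := by
  classical
  let G : RC ρ → Prop := fun h => h ≠ 0 ∧ RC.Lt (RC.abs h) δ ∧ x + h • v ∈ X
  have hw : ∀ h, ∃ w, G h → f (x + h • v) - f x - h * y = h * w ∧
      RC.Le (RC.abs w) (RC.abs C * RC.abs h) := fun h => by
    by_cases hG : G h
    · obtain ⟨w, hw⟩ := RC.exists_eq_mul_of_abs_le (hq h hG.2.1 hG.2.2)
      exact ⟨w, fun _ => hw⟩
    · exact ⟨0, fun h => absurd h hG⟩
  choose w hw using hw
  refine ⟨fun h => if h = 0 then y else y + w h, by simp, ⟨δ, hδ, fun h h1 h2 => ?_⟩,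
    fun η hη => ?_⟩
  · rcases eq_or_ne h 0 with h0 | h0
    · simp [h0]
    · simp only [if_neg h0]
      linear_combination (hw h ⟨h0, h1, h2⟩).1
  · obtain ⟨c, hc⟩ := exists_represents C
    obtain ⟨e, he⟩ := exists_represents η
    obtain ⟨N, hN⟩ := hc.isModerate
    obtain ⟨K, hK⟩ := (RC.lt_iff Represents.zero he).1 hη
    obtain ⟨K', hK'⟩ := RC.exists_lt_of_lt_gaugePow hδ
    refine ⟨RC.gaugePow ρ (max K' (N + K + 1)), RC.gaugePow_pos _, fun h h1 h2 => ?_⟩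
    rcases eq_or_ne h 0 with h0 | h0
    · have : RC.abs (0 : RC ρ) = 0 :=
        Represents.zero.abs.unique (by simpa using Represents.zero)
      simpa [h0, this] using hη
    · obtain ⟨s, hs⟩ := exists_represents h
      obtain ⟨W, hW⟩ := exists_represents (w h)
      obtain ⟨J, hJ⟩ := (RC.lt_iff hs.abs (RC.represents_gaugePow _)).1 h1
      have h3 := (hw h ⟨h0, hK' _ (le_max_left _ _) _ h1, h2⟩).2
      rw [RC.le_iff hW.abs (hc.abs.mul hs.abs)] at h3
      simp only [if_neg h0, add_sub_cancel_left]
      refine (RC.lt_iff hW.abs he).2 ⟨K + 1, ?_⟩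
      filter_upwards [hN, hK, hJ, h3 (K + 1), ρ.eventually_mul_pow_succ_le 3 K]
        with ε a1 a2 a3 a4 a5
      have b1 := ρ.pow_anti (le_max_right K' (N + K + 1)) ε
      have b2 := ρ.pow_pos J ε
      have b3 : |c ε| * |s ε| ≤ ρ ε ^ (K + 1) := by
        calc |c ε| * |s ε| ≤ (ρ ε ^ N)⁻¹ * ρ ε ^ (N + K + 1) :=
              mul_le_mul a1 (by linarith) (abs_nonneg _) (inv_nonneg.2 (ρ.pow_pos N ε).le)
          _ = ρ ε ^ (K + 1) := by
              rw [add_assoc, pow_add, inv_mul_cancel_left₀ (ρ.pow_pos N ε).ne']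
      linarith

/-- Incremental ratios determine the derivative as soon as there are arbitrarily small invertible
increments. -/
lemma HasDirDeriv.unique
    (hX : ∀ n : ℕ, ∃ h, IsUnit h ∧ RC.Lt (RC.abs h) (RC.gaugePow ρ n) ∧ x + h • v ∈ X)
    (h : HasDirDeriv X f x v y) (h' : HasDirDeriv X f x v y') : y = y' := by
  obtain ⟨r, -, ⟨δ, hδ, hr⟩, hc⟩ := h
  obtain ⟨r', -, ⟨δ', hδ', hr'⟩, hc'⟩ := h'
  obtain ⟨Y, hY⟩ := exists_represents y
  obtain ⟨Y', hY'⟩ := exists_represents y'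
  refine hY.eq_of_isNegligible_sub hY' fun n => ?_
  obtain ⟨η, hη, hcη⟩ := hc _ (RC.gaugePow_pos (n + 1))
  obtain ⟨η', hη', hcη'⟩ := hc' _ (RC.gaugePow_pos (n + 1))
  obtain ⟨N1, h1⟩ := RC.exists_lt_of_lt_gaugePow hδ
  obtain ⟨N2, h2⟩ := RC.exists_lt_of_lt_gaugePow hδ'
  obtain ⟨N3, h3⟩ := RC.exists_lt_of_lt_gaugePow hη
  obtain ⟨N4, h4⟩ := RC.exists_lt_of_lt_gaugePow hη'
  obtain ⟨h, hu, hh, hm⟩ := hX (N1 + N2 + N3 + N4)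
  have e1 := hr h (h1 _ (by omega) _ hh) hm
  have e2 := hr' h (h2 _ (by omega) _ hh) hm
  have e3 := hcη h (h3 _ (by omega) _ hh) hm
  have e4 := hcη' h (h4 _ (by omega) _ hh) hm
  have e5 : r h = r' h := by
    have : h * r h = h * r' h := by linear_combination e2 - e1
    exact hu.mul_left_cancel this
  rw [← e5] at e4
  obtain ⟨R, hR⟩ := exists_represents (r h)
  obtain ⟨J, hJ⟩ := (RC.lt_iff (hR.sub hY).abs (RC.represents_gaugePow _)).1 e3
  obtain ⟨J', hJ'⟩ := (RC.lt_iff (hR.sub hY').abs (RC.represents_gaugePow _)).1 e4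
  filter_upwards [hJ, hJ', ρ.eventually_mul_pow_succ_le 2 n] with ε a1 a2 a3
  have b1 := ρ.pow_pos J ε
  have b2 := ρ.pow_pos J' ε
  have b3 := abs_le.1 (le_trans (by linarith : |R ε - Y ε| ≤ |R ε - Y ε| + ρ ε ^ J) a1)
  have b4 := abs_le.1 (le_trans (by linarith : |R ε - Y' ε| ≤ |R ε - Y' ε| + ρ ε ^ J') a2)
  rw [abs_le]; constructor <;> linarith

lemma HasDirDeriv.congr (h : HasDirDeriv X f x v y) (hx : x ∈ X) (hfg : Set.EqOn f g X) :
    HasDirDeriv X g x v y := by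
  obtain ⟨r, h0, ⟨δ, hδ, hr⟩, hc⟩ := h
  exact ⟨r, h0, ⟨δ, hδ, fun h h1 h2 => by rw [← hfg h2, ← hfg hx]; exact hr h h1 h2⟩, hc⟩

lemma HasDirDeriv.hasDirDeriv_dirDeriv (h : HasDirDeriv X f x v y) :
    HasDirDeriv X f x v (dirDeriv X f v x) := by
  have h1 : ∃ y, HasDirDeriv X f x v y := ⟨y, h⟩
  rw [dirDeriv, dif_pos h1]
  exact h1.choose_spec

/-- Sufficiently small powers of the gauge are invertible increments of the whole ring. -/
lemma RC.exists_isUnit_lt_gaugePow (n : ℕ) :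
    ∃ h : RC ρ, IsUnit h ∧ RC.Lt (RC.abs h) (RC.gaugePow ρ n) := by
  have h1 := RC.represents_gaugePow (ρ := ρ) (n + 1)
  refine ⟨RC.gaugePow ρ (n + 1), (RC.isUnit_iff h1).2 ⟨n + 1, Eventually.of_forall fun ε =>
    le_abs_self _⟩, (RC.lt_iff h1.abs (RC.represents_gaugePow n)).2 ⟨n + 1, ?_⟩⟩
  filter_upwards [ρ.eventually_mul_pow_succ_le 2 n] with ε hε
  rw [abs_of_pos (ρ.pow_pos _ ε)]
  linarith

end DirDeriv

/-! ### Nets of smooth functions -/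

section SmoothNet

variable {ι κ : Type*}

lemma exists_representsPt (x : ι → RC ρ) : ∃ u, RepresentsPt u x := by
  choose u hu using fun i => exists_represents (x i)
  exact ⟨fun ε i => u i ε, hu⟩

lemma RepresentsPt.of_norm_sub_le [Fintype ι] {u u' v : Idx → ι → ℝ} {x : ι → RC ρ}
    (hu : RepresentsPt u x) (hu' : RepresentsPt u' x)
    (h : ∀ᶠ ε in atBot, ‖v ε - u ε‖ ≤ ‖u' ε - u ε‖) : RepresentsPt v x := by
  have hn : IsNegligible ρ fun ε => ‖u' ε - u ε‖ :=
    isNegligible_norm fun i => (hu' i).isNegligible_sub (hu i)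
  refine fun i => (hu i).of_isNegligible_sub (hn.of_le ?_)
  filter_upwards [h] with ε hε
  rw [abs_of_nonneg (norm_nonneg _)]
  exact (norm_le_pi_norm (v ε - u ε) i).trans hε

variable [Fintype ι] [Fintype κ]

/-- `(F_ε)` is a net of smooth functions on the open sets `Ω_ε` that defines a generalized
smooth function on `X`. -/
structure IsSmoothNet (X : Set (ι → RC ρ)) (Ω : Idx → Set (ι → ℝ))
    (F : Idx → (ι → ℝ) → ℝ) : Prop where
  isOpen : ∀ ε, IsOpen (Ω ε)
  contDiffOn : ∀ ε, ContDiffOn ℝ ∞ (F ε) (Ω ε)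
  subset : X ⊆ stronglyInternal Ω
  moderate : ∀ x ∈ X, ∀ u : Idx → ι → ℝ, RepresentsPt u x →
    ∀ k : ℕ, IsModerate ρ fun ε => ‖iteratedFDeriv ℝ k (F ε) (u ε)‖

/-- The net `(F_ε)` of smooth functions defines the generalized smooth function `f` on `X`. -/
structure HasNet (X : Set (ι → RC ρ)) (f : (ι → RC ρ) → RC ρ) (Ω : Idx → Set (ι → ℝ))
    (F : Idx → (ι → ℝ) → ℝ) : Prop extends IsSmoothNet X Ω F where
  represents : ∀ x ∈ X, ∀ u : Idx → ι → ℝ, RepresentsPt u x →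
    Represents (fun ε => F ε (u ε)) (f x)

variable {X : Set (ι → RC ρ)} {Y : Set (κ → RC ρ)} {f g : (ι → RC ρ) → RC ρ}
  {Ω Θ : Idx → Set (ι → ℝ)} {F G : Idx → (ι → ℝ) → ℝ}

lemma isGSF_iff_exists_hasNet : IsGSF X f ↔ ∃ Ω F, HasNet X f Ω F :=
  ⟨fun ⟨Ω, F, h1, h2, h3, h4⟩ => ⟨Ω, F, ⟨h1, h2, h3, fun x hx u hu => (h4 x hx u hu).2⟩,
    fun x hx u hu => (h4 x hx u hu).1⟩,
  fun ⟨Ω, F, h⟩ => ⟨Ω, F, h.isOpen, h.contDiffOn, h.subset, fun x hx u hu =>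
    ⟨h.represents x hx u hu, h.moderate x hx u hu⟩⟩⟩

lemma HasNet.isGSF (h : HasNet X f Ω F) : IsGSF X f := isGSF_iff_exists_hasNet.2 ⟨Ω, F, h⟩

namespace IsSmoothNet

lemma contDiffAt (h : IsSmoothNet X Ω F) {ε : Idx} {w : ι → ℝ} (hw : w ∈ Ω ε) :
    ContDiffAt ℝ ∞ (F ε) w := (h.contDiffOn ε).contDiffAt ((h.isOpen ε).mem_nhds hw)

lemma hasFDerivAt (h : IsSmoothNet X Ω F) {ε : Idx} {w : ι → ℝ} (hw : w ∈ Ω ε) :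
    HasFDerivAt (F ε) (fderiv ℝ (F ε) w) w :=
  ((h.contDiffAt hw).differentiableAt (by simp)).hasFDerivAt

/-- The directional derivatives of a smooth net form a smooth net. -/
lemma fderiv_apply (h : IsSmoothNet X Ω F) (e : ι → ℝ) :
    IsSmoothNet X Ω fun ε w => fderiv ℝ (F ε) w e where
  isOpen := h.isOpen
  contDiffOn ε := ((contDiffOn_infty_iff_fderiv_of_isOpen (h.isOpen ε)).1
    (h.contDiffOn ε)).2.clm_apply contDiffOn_const
  subset := h.subset
  moderate x hx u hu k := by
    refine ((isModerate_const ‖e‖).mul (h.moderate x hx u hu (k + 1))).of_le ?_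
    filter_upwards [h.subset hx u hu] with ε hε
    have h1 : ContDiffAt ℝ ∞ (fderiv ℝ (F ε)) (u ε) :=
      ((contDiffOn_infty_iff_fderiv_of_isOpen (h.isOpen ε)).1
        (h.contDiffOn ε)).2.contDiffAt ((h.isOpen ε).mem_nhds hε)
    have h2 := norm_iteratedFDeriv_clm_apply_const (c := e) (n := k) h1
      (by exact_mod_cast le_top)
    rw [norm_iteratedFDeriv_fderiv] at h2
    simpa [abs_mul] using h2

/-- Between two representatives of the same point, the derivatives are uniformly bounded. -/
lemma exists_bound_segment (h : IsSmoothNet X Ω F) {x : ι → RC ρ} (hx : x ∈ X)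
    {u u' : Idx → ι → ℝ} (hu : RepresentsPt u x) (hu' : RepresentsPt u' x) (k : ℕ) :
    ∃ N : ℕ, ∀ᶠ ε in atBot, ∀ w ∈ segment ℝ (u ε) (u' ε),
      w ∈ Ω ε ∧ ‖iteratedFDeriv ℝ k (F ε) w‖ ≤ (ρ ε ^ N)⁻¹ := by
  have hne : ∀ ε, (segment ℝ (u ε) (u' ε)).Nonempty := fun ε => ⟨_, left_mem_segment ℝ _ _⟩
  have hrep : ∀ v : Idx → ι → ℝ, (∀ ε, v ε ∈ segment ℝ (u ε) (u' ε)) → RepresentsPt v x :=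
    fun v hv => hu.of_norm_sub_le hu' <| Eventually.of_forall fun ε =>
      norm_sub_le_of_mem_segment (hv ε)
  obtain ⟨N, hN⟩ := exists_uniform_bound_of_nets (ρ := ρ) hne
    (g := fun ε w => ‖iteratedFDeriv ℝ k (F ε) w‖)
    fun v hv => h.moderate x hx v (hrep v hv) k
  refine ⟨N, ?_⟩
  filter_upwards [hN, eventually_forall_mem_of_nets hne (P := fun ε w => w ∈ Ω ε)
    fun v hv => h.subset hx v (hrep v hv)] with ε h1 h2 w hw
  exact ⟨h2 w hw, by simpa using h1 w hw⟩

/-- The values of a smooth net at two representatives of a point differ by a negligible net. -/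
lemma isNegligible_sub (h : IsSmoothNet X Ω F) {x : ι → RC ρ} (hx : x ∈ X)
    {u u' : Idx → ι → ℝ} (hu : RepresentsPt u x) (hu' : RepresentsPt u' x) :
    IsNegligible ρ fun ε => F ε (u' ε) - F ε (u ε) := by
  obtain ⟨N, hN⟩ := h.exists_bound_segment hx hu hu' 1
  have hn : IsNegligible ρ fun ε => ‖u' ε - u ε‖ :=
    isNegligible_norm fun i => (hu' i).isNegligible_sub (hu i)
  refine ((isModerate_inv_pow N).mul_negligible hn).of_le ?_
  filter_upwards [hN] with ε hε
  have := (convex_segment (𝕜 := ℝ) (u ε) (u' ε)).norm_image_sub_le_of_norm_hasFDerivWithin_le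
    (fun w hw => (h.hasFDerivAt (hε w hw).1).hasFDerivWithinAt)
    (fun w hw => by simpa [norm_iteratedFDeriv_one] using (hε w hw).2)
    (left_mem_segment ℝ _ _) (right_mem_segment ℝ _ _)
  refine this.trans (le_of_eq ?_)
  rw [Pi.mul_apply, abs_of_nonneg
    (mul_nonneg (inv_nonneg.2 (ρ.pow_pos N ε).le) (norm_nonneg _))]

lemma isModerate (h : IsSmoothNet X Ω F) {x : ι → RC ρ} (hx : x ∈ X)
    {u : Idx → ι → ℝ} (hu : RepresentsPt u x) : IsModerate ρ fun ε => F ε (u ε) :=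
  (h.moderate x hx u hu 0).of_le <| Eventually.of_forall fun ε => by simp

lemma exists_hasNet (h : IsSmoothNet X Ω F) : ∃ f, HasNet X f Ω F := by
  choose u hu using fun x : ι → RC ρ => exists_representsPt x
  have hy : ∀ x : ι → RC ρ, ∃ y : RC ρ, x ∈ X → Represents (fun ε => F ε (u x ε)) y := fun x => by
    by_cases hx : x ∈ X
    · obtain ⟨y, hy⟩ := (h.isModerate hx (hu x)).exists_represents
      exact ⟨y, fun _ => hy⟩
    · exact ⟨0, fun h => absurd h hx⟩
  choose f hf using hy
  exact ⟨f, h, fun x hx v hv => (hf x hx).of_isNegligible_sub (h.isNegligible_sub hx (hu x) hv)⟩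

end IsSmoothNet

namespace HasNet

lemma congr (h : HasNet X f Ω F) (hfg : Set.EqOn f g X) : HasNet X g Ω F :=
  { h with represents := fun x hx u hu => hfg hx ▸ h.represents x hx u hu }

lemma add (hf : HasNet X f Ω F) (hg : HasNet X g Θ G) :
    HasNet X (fun x => f x + g x) (fun ε => Ω ε ∩ Θ ε) fun ε w => F ε w + G ε w where
  isOpen ε := (hf.isOpen ε).inter (hg.isOpen ε)
  contDiffOn ε := ((hf.contDiffOn ε).mono Set.inter_subset_left).add
    ((hg.contDiffOn ε).mono Set.inter_subset_right)
  subset x hx u hu := (hf.subset hx u hu).and (hg.subset hx u hu)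
  moderate x hx u hu k := by
    refine ((hf.moderate x hx u hu k).add (hg.moderate x hx u hu k)).of_le ?_
    filter_upwards [hf.subset hx u hu, hg.subset hx u hu] with ε h1 h2
    have := iteratedFDeriv_add_apply (i := k) ((hf.contDiffAt h1).of_le (by exact_mod_cast le_top))
      ((hg.contDiffAt h2).of_le (by exact_mod_cast le_top))
    rw [abs_of_nonneg (norm_nonneg _)]
    refine le_trans ?_ (le_abs_self _)
    calc _ = ‖iteratedFDeriv ℝ k (F ε + G ε) (u ε)‖ := rfl
      _ ≤ _ := by rw [this]; exact norm_add_le _ _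
  represents x hx u hu := (hf.represents x hx u hu).add (hg.represents x hx u hu)

lemma mul (hf : HasNet X f Ω F) (hg : HasNet X g Θ G) :
    HasNet X (fun x => f x * g x) (fun ε => Ω ε ∩ Θ ε) fun ε w => F ε w * G ε w where
  isOpen ε := (hf.isOpen ε).inter (hg.isOpen ε)
  contDiffOn ε := ((hf.contDiffOn ε).mono Set.inter_subset_left).mul
    ((hg.contDiffOn ε).mono Set.inter_subset_right)
  subset x hx u hu := (hf.subset hx u hu).and (hg.subset hx u hu)
  moderate x hx u hu k := by
    refine (IsModerate.sum (Finset.range (k + 1)) fun i _ =>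
      ((isModerate_const ((k.choose i : ℕ) : ℝ)).mul (hf.moderate x hx u hu i)).mul
        (hg.moderate x hx u hu (k - i))).of_le ?_
    filter_upwards [hf.subset hx u hu, hg.subset hx u hu] with ε h1 h2
    have ho := (hf.isOpen ε).inter (hg.isOpen ε)
    have := norm_iteratedFDerivWithin_mul_le (n := k)
      ((hf.contDiffOn ε).mono (Set.inter_subset_left (t := Θ ε)))
      ((hg.contDiffOn ε).mono (Set.inter_subset_right (s := Ω ε)))
      ho.uniqueDiffOn ⟨h1, h2⟩ (by exact_mod_cast le_top)
    rw [abs_of_nonneg (norm_nonneg _)]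
    refine le_trans ?_ (le_abs_self _)
    simp only [fun j (φ : (ι → ℝ) → ℝ) => iteratedFDerivWithin_of_isOpen (𝕜 := ℝ) (f := φ) j ho
      (⟨h1, h2⟩ : u ε ∈ Ω ε ∩ Θ ε)] at this
    simpa using this
  represents x hx u hu := (hf.represents x hx u hu).mul (hg.represents x hx u hu)

lemma const {c : RC ρ} {u : Idx → ℝ} (hc : Represents u c) :
    HasNet X (fun _ => c) (fun _ => Set.univ) fun ε _ => u ε where
  isOpen _ := isOpen_univ
  contDiffOn _ := contDiffOn_const
  subset _ _ _ _ := Eventually.of_forall fun _ => Set.mem_univ _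
  moderate x hx v hv k := by
    rcases Nat.eq_zero_or_pos k with rfl | hk
    · simpa using hc.isModerate.abs
    · simpa [iteratedFDeriv_const_of_ne hk.ne'] using isModerate_const 0
  represents _ _ _ _ := hc

/-- The coordinate functions. -/
lemma coord (i : ι) : HasNet X (fun x => x i) (fun _ => Set.univ) fun _ w => w i where
  isOpen _ := isOpen_univ
  contDiffOn _ := (contDiff_apply ℝ ℝ i).contDiffOn
  subset _ _ _ _ := Eventually.of_forall fun _ => Set.mem_univ _
  moderate x hx v hv k := by
    have h0 : (fun w : ι → ℝ => w i) = ContinuousLinearMap.proj (R := ℝ) (φ := fun _ : ι => ℝ) i :=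
      rfl
    match k with
    | 0 => simpa using (hv i).isModerate.abs
    | k + 1 =>
      have h1 : fderiv ℝ (fun w : ι → ℝ => w i) =
          fun _ => ContinuousLinearMap.proj (R := ℝ) (φ := fun _ : ι => ℝ) i := by
        rw [h0]; ext1 w; exact ContinuousLinearMap.fderiv _
      refine (isModerate_const
        ‖ContinuousLinearMap.proj (R := ℝ) (φ := fun _ : ι => ℝ) i‖).of_le
        (Eventually.of_forall fun ε => ?_)
      rw [← norm_iteratedFDeriv_fderiv, h1]
      rcases Nat.eq_zero_or_pos k with rfl | hk
      · simp
      · simp [iteratedFDeriv_const_of_ne hk.ne']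
  represents x hx u hu := hu i

end HasNet

/-- The norm of a derivative of a map into `ι → ℝ` is controlled by its components. -/
lemma norm_iteratedFDerivWithin_pi_le {s : Set (κ → ℝ)} (hs : UniqueDiffOn ℝ s)
    {G : (κ → ℝ) → ι → ℝ} {w : κ → ℝ} (hw : w ∈ s)
    (hG : ContDiffOn ℝ ∞ G s) (n : ℕ) :
    ‖iteratedFDerivWithin ℝ n G s w‖ ≤
      ∑ i, ‖iteratedFDerivWithin ℝ n (fun y => G y i) s w‖ := by
  refine ContinuousMultilinearMap.opNorm_le_bound (by positivity) fun m => ?_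
  refine (pi_norm_le_iff_of_nonneg (by positivity)).2 fun i => ?_
  have h1 := (ContinuousLinearMap.proj (R := ℝ) (φ := fun _ : ι => ℝ) i).iteratedFDerivWithin_comp_left
    (hG w hw) hs hw (i := n) (by exact_mod_cast le_top)
  have h2 : iteratedFDerivWithin ℝ n G s w m i =
      iteratedFDerivWithin ℝ n (fun y => G y i) s w m := by
    have : (fun y => G y i) = (ContinuousLinearMap.proj (R := ℝ) (φ := fun _ : ι => ℝ) i) ∘ G := rfl
    rw [this, h1]; rfl
  rw [h2]
  refine ((iteratedFDerivWithin ℝ n (fun y => G y i) s w).le_opNorm m).trans ?_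
  gcongr
  exact Finset.single_le_sum (f := fun i => ‖iteratedFDerivWithin ℝ n (fun y => G y i) s w‖)
    (fun _ _ => norm_nonneg _) (Finset.mem_univ i)

/-- Composition of generalized smooth functions. -/
lemma HasNet.comp (hf : HasNet X f Ω F) {g : ι → (κ → RC ρ) → RC ρ}
    {Θ : ι → Idx → Set (κ → ℝ)} {G : ι → Idx → (κ → ℝ) → ℝ}
    (hg : ∀ i, HasNet Y (g i) (Θ i) (G i)) (hm : ∀ y ∈ Y, (fun i => g i y) ∈ X) :
    HasNet Y (fun y => f fun i => g i y)
      (fun ε => (⋂ i, Θ i ε) ∩ {w | (fun i => G i ε w) ∈ Ω ε})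
      fun ε w => F ε fun i => G i ε w := by
  have hG : ∀ ε, ContDiffOn ℝ ∞ (fun w i => G i ε w) (⋂ i, Θ i ε) := fun ε =>
    contDiffOn_pi.2 fun i => ((hg i).contDiffOn ε).mono (Set.iInter_subset _ i)
  have hopen : ∀ ε, IsOpen ((⋂ i, Θ i ε) ∩ {w | (fun i => G i ε w) ∈ Ω ε}) := fun ε =>
    (hG ε).continuousOn.isOpen_inter_preimage (isOpen_iInter_of_finite fun i => (hg i).isOpen ε)
      (hf.isOpen ε)
  have hsub : ∀ y ∈ Y, ∀ u : Idx → κ → ℝ, RepresentsPt u y →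
      ∀ᶠ ε in atBot, u ε ∈ (⋂ i, Θ i ε) ∩ {w | (fun i => G i ε w) ∈ Ω ε} := by
    intro y hy u hu
    filter_upwards [eventually_all.2 fun i => (hg i).subset hy u hu,
      hf.subset (hm y hy) (fun ε i => G i ε (u ε)) fun i => (hg i).represents y hy u hu]
      with ε h1 h2
    exact ⟨Set.mem_iInter.2 h1, h2⟩
  refine ⟨⟨hopen, fun ε => ?_, hsub, fun y hy u hu n => ?_⟩, fun y hy u hu => ?_⟩
  · exact (hf.contDiffOn ε).comp ((hG ε).mono Set.inter_subset_left) fun w hw => hw.2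
  · have hrep : RepresentsPt (fun ε i => G i ε (u ε)) fun i => g i y :=
      fun i => (hg i).represents y hy u hu
    let C : Idx → ℝ := fun ε => ∑ i ∈ Finset.range (n + 1),
      ‖iteratedFDeriv ℝ i (F ε) fun i => G i ε (u ε)‖
    let D : Idx → ℝ := fun ε => 1 + ∑ j ∈ Finset.range (n + 1), ∑ i,
      ‖iteratedFDeriv ℝ j (G i ε) (u ε)‖
    have hC : IsModerate ρ C := IsModerate.sum _ fun i _ => hf.moderate _ (hm y hy) _ hrep i
    have hD : IsModerate ρ D := (isModerate_const 1).add <|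
      IsModerate.sum _ fun j _ => IsModerate.sum _ fun i _ => (hg i).moderate y hy u hu j
    refine (((isModerate_const ((n.factorial : ℕ) : ℝ)).mul hC).mul (hD.pow n)).of_le ?_
    filter_upwards [hsub y hy u hu] with ε hε
    have hso := hopen ε
    set s := (⋂ i, Θ i ε) ∩ {w | (fun i => G i ε w) ∈ Ω ε} with hs
    have hD1 : 1 ≤ D ε := le_add_of_nonneg_right (by positivity)
    have := norm_iteratedFDerivWithin_comp_le (n := n) (hf.contDiffOn ε)
      ((hG ε).mono (Set.inter_subset_left : s ⊆ _)) (by exact_mod_cast le_top)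
      (hf.isOpen ε).uniqueDiffOn hso.uniqueDiffOn (fun w hw => hw.2) hε
      (C := C ε) (D := D ε) (fun i hi => ?_) (fun j hj1 hj => ?_)
    · rw [iteratedFDerivWithin_of_isOpen _ hso hε] at this
      rw [abs_of_nonneg (norm_nonneg _)]
      exact this.trans (le_abs_self _)
    · rw [iteratedFDerivWithin_of_isOpen _ (hf.isOpen ε) hε.2]
      exact Finset.single_le_sum
        (f := fun i => ‖iteratedFDeriv ℝ i (F ε) fun i => G i ε (u ε)‖)
        (fun _ _ => norm_nonneg _) (Finset.mem_range.2 (by omega))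
    · refine (norm_iteratedFDerivWithin_pi_le hso.uniqueDiffOn hε
        ((hG ε).mono Set.inter_subset_left) j).trans ?_
      refine le_trans ?_ (le_self_pow₀ hD1 (by omega))
      refine le_trans ?_ (le_add_of_nonneg_left zero_le_one)
      simp only [fun (φ : (κ → ℝ) → ℝ) => iteratedFDerivWithin_of_isOpen (𝕜 := ℝ) (f := φ) j hso hε]
      exact Finset.single_le_sum
        (f := fun j => ∑ i, ‖iteratedFDeriv ℝ j (G i ε) (u ε)‖)
        (fun _ _ => by positivity) (Finset.mem_range.2 (by omega))
  · exact hf.represents _ (hm y hy) _ fun i => (hg i).represents y hy u hu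

end SmoothNet

/-! ### Intervals and slabs -/

section Slab

variable {ι : Type*} {a b : RC ρ} {α β : Idx → ℝ}

/-- Nets of end points of a non-degenerate interval. -/
structure IsEndpoints (a b : RC ρ) (α β : Idx → ℝ) : Prop where
  left : Represents α a
  right : Represents β b
  le : ∀ ε, α ε ≤ β ε
  gap : ∃ N : ℕ, ∀ᶠ ε in atBot, ρ ε ^ N ≤ β ε - α ε

lemma exists_isEndpoints (hab : RC.Lt a b) : ∃ α β, IsEndpoints a b α β := by
  obtain ⟨α, β, hα, hβ, h⟩ := hab.1
  obtain ⟨N, hN⟩ := (RC.lt_iff hα hβ).1 hab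
  exact ⟨α, β, hα, hβ, h, N, hN.mono fun ε h => by linarith⟩

namespace IsEndpoints

lemma exists_represents (h : IsEndpoints a b α β) {x : RC ρ} (hx : x ∈ RC.interval a b) :
    ∃ u, Represents u x ∧ ∀ ε, u ε ∈ Set.Icc (α ε) (β ε) := by
  obtain ⟨u, hu⟩ := RobinsonColombeau.exists_represents x
  refine ⟨fun ε => max (α ε) (min (u ε) (β ε)), hu.of_isNegligible_sub fun n => ?_,
    fun ε => ⟨le_max_left _ _, max_le (h.le ε) (min_le_right _ _)⟩⟩
  filter_upwards [(RC.le_iff h.left hu).1 hx.1 n, (RC.le_iff hu h.right).1 hx.2 n] with ε h1 h2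
  have h3 := h.le ε
  have h4 := ρ.pow_pos n ε
  rw [abs_le]
  rcases max_cases (α ε) (min (u ε) (β ε)) with h | h <;>
  rcases min_cases (u ε) (β ε) with h' | h' <;> constructor <;> linarith

lemma mem_interval (h : IsEndpoints a b α β) {x : RC ρ} {u : Idx → ℝ} (hu : Represents u x)
    (hm : ∀ᶠ ε in atBot, u ε ∈ Set.Icc (α ε) (β ε)) : x ∈ RC.interval a b :=
  ⟨RC.le_of_eventually_le h.left hu (hm.mono fun _ h => h.1),
    RC.le_of_eventually_le hu h.right (hm.mono fun _ h => h.2)⟩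

lemma left_mem (h : IsEndpoints a b α β) : a ∈ RC.interval a b :=
  h.mem_interval h.left (Eventually.of_forall fun ε => ⟨le_rfl, h.le ε⟩)

lemma right_mem (h : IsEndpoints a b α β) : b ∈ RC.interval a b :=
  h.mem_interval h.right (Eventually.of_forall fun ε => ⟨h.le ε, le_rfl⟩)

lemma isModerate_of_mem (h : IsEndpoints a b α β) {u : Idx → ℝ}
    (hu : ∀ ε, u ε ∈ Set.Icc (α ε) (β ε)) : IsModerate ρ u :=
  (h.left.isModerate.abs.add h.right.isModerate.abs).of_le <| Eventually.of_forall fun ε => by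
    have h0 := abs_nonneg (α ε)
    have h1 := abs_nonneg (β ε)
    rw [Pi.add_apply, abs_of_nonneg (add_nonneg h0 h1), abs_le]
    constructor
    · linarith [(hu ε).1, neg_abs_le (α ε)]
    · linarith [(hu ε).2, le_abs_self (β ε)]

/-- Every point of a non-degenerate interval has arbitrarily small invertible increments that
lead into the interior of the interval: they point towards the farther end. -/
lemma exists_increment (h : IsEndpoints a b α β) {x : RC ρ} (hx : x ∈ RC.interval a b) (n : ℕ) :
    ∃ t, IsUnit t ∧ RC.Lt (RC.abs t) (RC.gaugePow ρ n) ∧ x + t ∈ RC.interval a b ∧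
      IsUnit (x + t - a) ∧ IsUnit (b - (x + t)) := by
  obtain ⟨u, hu, hm⟩ := h.exists_represents hx
  obtain ⟨N, hN⟩ := h.gap
  let K := N + n + 2
  let s : Idx → ℝ := fun ε => if u ε ≤ (α ε + β ε) / 2 then ρ ε ^ K else -ρ ε ^ K
  have hs : ∀ ε, |s ε| = ρ ε ^ K := fun ε => by
    by_cases hc : u ε ≤ (α ε + β ε) / 2 <;> simp [s, hc, abs_of_pos (ρ.pow_pos K ε)]
  have hsm : IsModerate ρ s := (isModerate_pow K).of_le <| Eventually.of_forall fun ε => by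
    rw [hs]; exact le_abs_self _
  obtain ⟨t, ht⟩ := hsm.exists_represents
  have key : ∀ᶠ ε in atBot, ρ ε ^ K ≤ u ε + s ε - α ε ∧ ρ ε ^ K ≤ β ε - (u ε + s ε) := by
    filter_upwards [hN, ρ.eventually_mul_pow_succ_le 2 N, ρ.eventually_mul_pow_succ_le 2 (N + 1)]
      with ε h1 h2 h3
    have h4 := ρ.pow_anti (show N + 1 + 1 ≤ K by omega) ε
    have h5 := hm ε
    by_cases hc : u ε ≤ (α ε + β ε) / 2
    · simp only [s, if_pos hc]
      constructor <;> linarith [h5.1, h5.2]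
    · simp only [s, if_neg hc]
      constructor <;> linarith [h5.1, h5.2, not_le.1 hc]
  refine ⟨t, (RC.isUnit_iff ht).2 ⟨K, Eventually.of_forall fun ε => (hs ε).ge⟩,
    (RC.lt_iff ht.abs (RC.represents_gaugePow n)).2 ⟨n + 1, ?_⟩,
    h.mem_interval (hu.add ht) (key.mono fun ε hε => ?_),
    (RC.isUnit_iff ((hu.add ht).sub h.left)).2
      ⟨K, key.mono fun ε hε => hε.1.trans (le_abs_self _)⟩,
    (RC.isUnit_iff (h.right.sub (hu.add ht))).2
      ⟨K, key.mono fun ε hε => hε.2.trans (le_abs_self _)⟩⟩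
  · filter_upwards [ρ.eventually_mul_pow_succ_le 2 n] with ε h1
    rw [hs]
    have := ρ.pow_anti (show n + 1 ≤ K by omega) ε
    linarith
  · have := ρ.pow_pos K ε
    constructor <;> linarith [hε.1, hε.2]

end IsEndpoints

/-- The points of `RC^ι` whose coordinate `i₀` belongs to `[a,b]`. -/
def slab (i₀ : ι) (a b : RC ρ) : Set (ι → RC ρ) := {x | x i₀ ∈ RC.interval a b}

/-- The points whose coordinate `i₀` lies between `α_ε` and `β_ε`, within a ball of radius
`ρ_ε ^ (-K)` centred at a point of the slab, so that the box is not empty. -/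
def netBox (ρ : Gauge) (α β : Idx → ℝ) (i₀ : ι) [Fintype ι] (K : ℕ) (ε : Idx) : Set (ι → ℝ) :=
  {w | w i₀ ∈ Set.Icc (α ε) (β ε) ∧ w ∈ Metric.closedBall (fun _ => α ε) (ρ ε ^ K)⁻¹}

variable [Fintype ι] {i₀ : ι}

lemma convex_netBox (K : ℕ) (ε : Idx) : Convex ℝ (netBox ρ α β i₀ K ε) :=
  ((convex_Icc (α ε) (β ε)).linear_preimage (LinearMap.proj (R := ℝ) (φ := fun _ : ι => ℝ) i₀)).inter
    (convex_closedBall _ _)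

lemma IsEndpoints.netBox_nonempty (h : IsEndpoints a b α β) (K : ℕ) (ε : Idx) :
    (netBox ρ α β i₀ K ε).Nonempty :=
  ⟨fun _ => α ε, ⟨le_rfl, h.le ε⟩, Metric.mem_closedBall_self (inv_nonneg.2 (ρ.pow_pos K ε).le)⟩

/-- A net of points in boxes represents a point of the slab. -/
lemma IsEndpoints.exists_representsPt_of_mem_netBox (h : IsEndpoints a b α β) {K : ℕ}
    {v : Idx → ι → ℝ} (hv : ∀ ε, v ε ∈ netBox ρ α β i₀ K ε) :
    ∃ x ∈ slab i₀ a b, RepresentsPt v x := by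
  have hm : ∀ i, IsModerate ρ fun ε => v ε i := fun i => by
    refine ((isModerate_inv_pow K).add h.left.isModerate.abs).of_le
      (Eventually.of_forall fun ε => ?_)
    have h1 : |v ε i - α ε| ≤ (ρ ε ^ K)⁻¹ :=
      (norm_le_pi_norm (v ε - fun _ => α ε) i).trans (by simpa [dist_eq_norm] using (hv ε).2)
    have h2 : |v ε i| ≤ |v ε i - α ε| + |α ε| := by
      simpa using abs_add_le (v ε i - α ε) (α ε)
    exact (h2.trans (by simpa using h1)).trans (le_abs_self _)
  choose x hx using fun i => (hm i).exists_represents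
  exact ⟨x, h.mem_interval (hx i₀) (Eventually.of_forall fun ε => (hv ε).1), hx⟩

/-- The number `x` is bounded by `ρ_ε ^ (-K)`. -/
def RC.BoundedBy (K : ℕ) (x : RC ρ) : Prop :=
  ∃ u, Represents u x ∧ ∀ᶠ ε in atBot, |u ε| ≤ (ρ ε ^ K)⁻¹

lemma RC.exists_boundedBy (x : RC ρ) : ∃ K, RC.BoundedBy K x := by
  obtain ⟨u, hu⟩ := exists_represents x
  obtain ⟨K, hK⟩ := hu.isModerate
  exact ⟨K, u, hu, hK⟩

lemma RC.BoundedBy.mono {K K' : ℕ} {x : RC ρ} (h : RC.BoundedBy K x) (hK : K ≤ K') :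
    RC.BoundedBy K' x := by
  obtain ⟨u, hu, h⟩ := h
  exact ⟨u, hu, h.mono fun ε h => h.trans (inv_pow_le_inv_pow ε hK)⟩

lemma Gauge.eventually_mul_inv_pow_le (ρ : Gauge) (C : ℝ) (K : ℕ) :
    ∀ᶠ ε in atBot, C * (ρ ε ^ K)⁻¹ ≤ (ρ ε ^ (K + 1))⁻¹ := by
  filter_upwards [ρ.eventually_le_inv C] with ε h
  rw [pow_succ, mul_inv, mul_comm]
  exact mul_le_mul_of_nonneg_left (by simpa using h) (inv_nonneg.2 (ρ.pow_pos K ε).le)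

lemma RC.BoundedBy.eventually_le {K : ℕ} {x : RC ρ} (h : RC.BoundedBy K x) {v : Idx → ℝ}
    (hv : Represents v x) : ∀ᶠ ε in atBot, |v ε| ≤ (ρ ε ^ (K + 1))⁻¹ := by
  obtain ⟨u, hu, h⟩ := h
  filter_upwards [h, hv.isNegligible_sub hu 0, ρ.eventually_mul_inv_pow_le 2 K] with ε h1 h2 h3
  have h4 := ρ.one_le_inv K ε
  have h5 : |v ε| ≤ |v ε - u ε| + |u ε| := by simpa using abs_add_le (v ε - u ε) (u ε)
  rw [pow_zero] at h2
  linarith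

lemma RC.BoundedBy.add {K : ℕ} {x y : RC ρ} (hx : RC.BoundedBy K x) (hy : RC.BoundedBy K y) :
    RC.BoundedBy (K + 1) (x + y) := by
  obtain ⟨u, hu, h⟩ := hx
  obtain ⟨v, hv, h'⟩ := hy
  refine ⟨_, hu.add hv, ?_⟩
  filter_upwards [h, h', ρ.eventually_mul_inv_pow_le 2 K] with ε h1 h2 h3
  have := abs_add_le (u ε) (v ε)
  linarith

/-- Points of the slab with bounded coordinates are represented by nets in boxes whose size
depends only on the bound. -/
lemma IsEndpoints.exists_representsPt_mem_netBox (h : IsEndpoints a b α β) (K : ℕ) :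
    ∃ K', ∀ x ∈ slab i₀ a b, (∀ i, RC.BoundedBy K (x i)) →
      ∃ u, RepresentsPt u x ∧ ∀ᶠ ε in atBot, u ε ∈ netBox ρ α β i₀ K' ε := by
  classical
  obtain ⟨A, hA⟩ := h.left.isModerate
  refine ⟨K + A + 2, fun x hx hb => ?_⟩
  obtain ⟨v, hv⟩ := exists_representsPt x
  obtain ⟨z, hz, hzm⟩ := h.exists_represents hx
  let u : Idx → ι → ℝ := fun ε => Function.update (v ε) i₀ (z ε)
  have hu : RepresentsPt u x := fun i => by
    rcases eq_or_ne i i₀ with rfl | hi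
    · simpa [u] using hz
    · simpa [u, hi] using hv i
  refine ⟨u, hu, ?_⟩
  filter_upwards [eventually_all.2 fun i => (hb i).eventually_le (hu i), hA,
    ρ.eventually_mul_inv_pow_le 2 (K + A + 1)] with ε h1 h2 h3
  refine ⟨by simpa [u] using hzm ε, ?_⟩
  rw [mem_closedBall_iff_norm, pi_norm_le_iff_of_nonneg (inv_nonneg.2 (ρ.pow_pos _ ε).le)]
  intro i
  have h4 := inv_pow_le_inv_pow (ρ := ρ) ε (show K + 1 ≤ K + A + 1 by omega)
  have h5 := inv_pow_le_inv_pow (ρ := ρ) ε (show A ≤ K + A + 1 by omega)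
  have h6 : |u ε i - α ε| ≤ |u ε i| + |α ε| := abs_sub _ _
  have h7 := h1 i
  simp only [Pi.sub_apply, Real.norm_eq_abs]
  linarith

variable {Ω : Idx → Set (ι → ℝ)} {F : Idx → (ι → ℝ) → ℝ} {f : (ι → RC ρ) → RC ρ}
  {g : ι → (ι → RC ρ) → RC ρ}

/-- The derivatives of a smooth net are moderate uniformly on boxes. -/
lemma IsSmoothNet.exists_bound_netBox (h : IsSmoothNet (slab i₀ a b) Ω F)
    (he : IsEndpoints a b α β) (K k : ℕ) :
    ∃ N : ℕ, ∀ᶠ ε in atBot, ∀ w ∈ netBox ρ α β i₀ K ε,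
      w ∈ Ω ε ∧ ‖iteratedFDeriv ℝ k (F ε) w‖ ≤ (ρ ε ^ N)⁻¹ := by
  obtain ⟨N, hN⟩ := exists_uniform_bound_of_nets (ρ := ρ) (he.netBox_nonempty (i₀ := i₀) K)
    (g := fun ε w => ‖iteratedFDeriv ℝ k (F ε) w‖) fun v hv => by
      obtain ⟨x, hx, hvx⟩ := he.exists_representsPt_of_mem_netBox hv
      exact h.moderate x hx v hvx k
  refine ⟨N, ?_⟩
  filter_upwards [hN, eventually_forall_mem_of_nets (he.netBox_nonempty (i₀ := i₀) K)
    (P := fun ε w => w ∈ Ω ε) fun v hv => by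
      obtain ⟨x, hx, hvx⟩ := he.exists_representsPt_of_mem_netBox hv
      exact h.subset hx v hvx] with ε h1 h2 w hw
  exact ⟨h2 w hw, by simpa using h1 w hw⟩

/-- Second order Taylor estimate, uniform on boxes. -/
lemma IsSmoothNet.exists_taylor_netBox (h : IsSmoothNet (slab i₀ a b) Ω F)
    (he : IsEndpoints a b α β) (K : ℕ) :
    ∃ N : ℕ, ∀ᶠ ε in atBot, ∀ p ∈ netBox ρ α β i₀ K ε, ∀ w ∈ netBox ρ α β i₀ K ε,
      |F ε w - F ε p - fderiv ℝ (F ε) p (w - p)| ≤ (ρ ε ^ N)⁻¹ * ‖w - p‖ ^ 2 := by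
  obtain ⟨N, hN⟩ := h.exists_bound_netBox he K 2
  refine ⟨N, ?_⟩
  filter_upwards [hN] with ε hε p hp w hw
  have hc := convex_netBox (ρ := ρ) (α := α) (β := β) (i₀ := i₀) K ε
  have hC : 0 ≤ (ρ ε ^ N)⁻¹ := inv_nonneg.2 (ρ.pow_pos N ε).le
  have hdd : ∀ z ∈ netBox ρ α β i₀ K ε, HasFDerivWithinAt (fderiv ℝ (F ε))
      (fderiv ℝ (fderiv ℝ (F ε)) z) (netBox ρ α β i₀ K ε) z := fun z hz => by
    have h1 : ContDiffAt ℝ ∞ (fderiv ℝ (F ε)) z :=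
      ((contDiffOn_infty_iff_fderiv_of_isOpen (h.isOpen ε)).1
        (h.contDiffOn ε)).2.contDiffAt ((h.isOpen ε).mem_nhds (hε z hz).1)
    exact (h1.differentiableAt (by simp)).hasFDerivAt.hasFDerivWithinAt
  have hseg := hc.segment_subset hp hw
  have h1 : ∀ z ∈ segment ℝ p w,
      ‖fderiv ℝ (F ε) z - fderiv ℝ (F ε) p‖ ≤ (ρ ε ^ N)⁻¹ * ‖w - p‖ := fun z hz => by
    refine (hc.norm_image_sub_le_of_norm_hasFDerivWithin_le hdd (fun y hy => ?_) hp
      (hseg hz)).trans (mul_le_mul_of_nonneg_left (norm_sub_le_of_mem_segment hz) hC)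
    rw [← norm_iteratedFDeriv_one, norm_iteratedFDeriv_fderiv]
    exact (hε y hy).2
  have h2 := (convex_segment (𝕜 := ℝ) p w).norm_image_sub_le_of_norm_hasFDerivWithin_le'
    (fun z hz => (h.hasFDerivAt (hε z (hseg hz)).1).hasFDerivWithinAt) h1
    (left_mem_segment ℝ _ _) (right_mem_segment ℝ _ _)
  rw [pow_two, ← mul_assoc]
  exact h2

/-- Second order Taylor estimate for a generalized smooth function on a slab. -/
lemma HasNet.exists_taylor [DecidableEq ι] (h : HasNet (slab i₀ a b) f Ω F)
    (hg : ∀ j, HasNet (slab i₀ a b) (g j) Ω fun ε w => fderiv ℝ (F ε) w (Pi.single j 1))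
    (hab : RC.Lt a b) (K : ℕ) :
    ∃ N : ℕ, ∃ C : RC ρ, Represents (fun ε => (ρ ε ^ N)⁻¹) C ∧
      ∀ x ∈ slab i₀ a b, ∀ y ∈ slab i₀ a b,
        (∀ i, RC.BoundedBy K (x i)) → (∀ i, RC.BoundedBy K (y i)) →
        RC.Le (RC.abs (f y - f x - ∑ j, g j x * (y j - x j)))
          (C * ∑ j, (y j - x j) * (y j - x j)) := by
  obtain ⟨α, β, he⟩ := exists_isEndpoints hab
  obtain ⟨K', hK'⟩ := he.exists_representsPt_mem_netBox (i₀ := i₀) K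
  obtain ⟨N, hN⟩ := h.exists_taylor_netBox he K'
  obtain ⟨C, hC⟩ := (isModerate_inv_pow (ρ := ρ) N).exists_represents
  refine ⟨N, C, hC, fun x hx y hy hbx hby => ?_⟩
  obtain ⟨u, hu, hum⟩ := hK' x hx hbx
  obtain ⟨v, hv, hvm⟩ := hK' y hy hby
  have hd := fun j => (hv j).sub (hu j)
  refine RC.le_of_eventually_le
    ((((h.represents y hy v hv).sub (h.represents x hx u hu)).sub
      (Represents.sum _ fun j _ => ((hg j).represents x hx u hu).mul (hd j))).abs)
    (hC.mul (Represents.sum _ fun j _ => (hd j).mul (hd j))) ?_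
  filter_upwards [hN, hum, hvm] with ε h1 h2 h3
  have h4 : fderiv ℝ (F ε) (u ε) (v ε - u ε) =
      ∑ j, fderiv ℝ (F ε) (u ε) (Pi.single j 1) * (v ε j - u ε j) := by
    conv_lhs => rw [pi_eq_sum_univ' (v ε - u ε)]
    rw [map_sum]
    refine Finset.sum_congr rfl fun j _ => ?_
    rw [map_smul, smul_eq_mul, mul_comm]
    congr 2
  rw [← h4]
  refine (h1 _ h2 _ h3).trans
    (mul_le_mul_of_nonneg_left ?_ (inv_nonneg.2 (ρ.pow_pos N ε).le))
  have h0 : 0 ≤ ∑ j, (v ε j - u ε j) * (v ε j - u ε j) :=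
    Finset.sum_nonneg fun j _ => mul_self_nonneg _
  have h5 : ‖v ε - u ε‖ ≤ √(∑ j, (v ε j - u ε j) * (v ε j - u ε j)) :=
    (pi_norm_le_iff_of_nonneg (Real.sqrt_nonneg _)).2 fun j => by
      refine Real.le_sqrt_of_sq_le ?_
      rw [Real.norm_eq_abs, sq_abs, pow_two]
      exact Finset.single_le_sum (f := fun j => (v ε j - u ε j) * (v ε j - u ε j))
        (fun _ _ => mul_self_nonneg _) (Finset.mem_univ j)
  calc ‖v ε - u ε‖ ^ 2 ≤ √(∑ j, (v ε j - u ε j) * (v ε j - u ε j)) ^ 2 := by gcongr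
    _ = _ := Real.sq_sqrt h0

/-- The derivative of a generalized smooth function along a coordinate is given by the net of
partial derivatives. -/
lemma HasNet.hasDirDeriv_single [DecidableEq ι] (h : HasNet (slab i₀ a b) f Ω F)
    (hg : ∀ j, HasNet (slab i₀ a b) (g j) Ω fun ε w => fderiv ℝ (F ε) w (Pi.single j 1))
    (hab : RC.Lt a b) {x : ι → RC ρ} (hx : x ∈ slab i₀ a b) (j : ι) :
    HasDirDeriv (slab i₀ a b) f x (Pi.single j 1) (g j x) := by
  choose K hK using fun i => RC.exists_boundedBy (x i)
  let K₀ := ∑ i, K i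
  have hK₀ : ∀ i, RC.BoundedBy K₀ (x i) := fun i =>
    (hK i).mono (Finset.single_le_sum (fun _ _ => Nat.zero_le _) (Finset.mem_univ i))
  obtain ⟨N, C, -, hC⟩ := h.exists_taylor hg hab (K₀ + 1)
  refine HasDirDeriv.of_quadratic (C := C) (RC.gaugePow_pos 0) fun t ht hxt => ?_
  have htb : RC.BoundedBy K₀ t := by
    obtain ⟨u, hu⟩ := exists_represents t
    obtain ⟨J, hJ⟩ := (RC.lt_iff hu.abs (RC.represents_gaugePow 0)).1 ht
    refine ⟨u, hu, hJ.mono fun ε h => ?_⟩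
    have h1 := ρ.one_le_inv K₀ ε
    have h2 := ρ.pow_pos J ε
    rw [pow_zero] at h
    linarith
  have key := hC x hx (x + t • Pi.single j 1) hxt (fun i => (hK₀ i).mono (by omega)) fun i => by
    by_cases hij : i = j
    · subst hij
      simpa using (hK₀ i).add htb
    · simpa [hij] using (hK₀ i).mono (by omega : K₀ ≤ K₀ + 1)
  have e0 : ∀ k, (x + t • (Pi.single j 1 : ι → RC ρ)) k - x k = if k = j then t else 0 :=
    fun k => by
      by_cases hk : k = j
      · subst hk; simp
      · simp [hk]
  simp only [e0] at key
  simpa [mul_comm] using key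


end Slab

/-! ### Calculus of one variable -/

section OneVariable

variable {a b t y : RC ρ} {f g F G : RC ρ → RC ρ}

lemma HasDirDeriv.of_slab
    (h : HasDirDeriv (slab () a b) (fun x => f (x ())) (fun _ => t) (Pi.single () 1) y) :
    HasDirDeriv (RC.interval a b) f t 1 y := by
  have e : ∀ s : RC ρ, ((fun _ => t) + s • Pi.single () 1 : Unit → RC ρ) () = t + s • 1 :=
    fun s => by simp
  simpa only [HasDirDeriv, slab, Set.mem_ofPred_eq, e] using h

lemma HasDirDeriv.unique_interval (hab : RC.Lt a b) (ht : t ∈ RC.interval a b) {y' : RC ρ}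
    (h : HasDirDeriv (RC.interval a b) f t 1 y) (h' : HasDirDeriv (RC.interval a b) f t 1 y') :
    y = y' := by
  obtain ⟨α, β, he⟩ := exists_isEndpoints hab
  refine HasDirDeriv.unique (fun n => ?_) h h'
  obtain ⟨s, h1, h2, h3, -⟩ := he.exists_increment ht n
  exact ⟨s, h1, h2, by simpa using h3⟩

lemma HasDirDeriv.dirDeriv_eq (h : HasDirDeriv (RC.interval a b) f t 1 y) (hab : RC.Lt a b)
    (ht : t ∈ RC.interval a b) : dirDeriv (RC.interval a b) f 1 t = y :=
  h.hasDirDeriv_dirDeriv.unique_interval hab ht h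

lemma dirDeriv_congr (h : Set.EqOn f g (RC.interval a b)) :
    Set.EqOn (dirDeriv (RC.interval a b) f 1) (dirDeriv (RC.interval a b) g 1)
      (RC.interval a b) := fun t ht => by
  have : HasDirDeriv (RC.interval a b) f t 1 = HasDirDeriv (RC.interval a b) g t 1 :=
    funext fun y => propext ⟨fun h' => h'.congr ht h, fun h' => h'.congr ht h.symm⟩
  rw [dirDeriv, dirDeriv, this]

variable {Ω Θ : Idx → Set (Unit → ℝ)} {Φ Ψ : Idx → (Unit → ℝ) → ℝ}

lemma HasNet.exists_partial {ι : Type*} [Fintype ι] {X : Set (ι → RC ρ)}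
    {f : (ι → RC ρ) → RC ρ} {Ω : Idx → Set (ι → ℝ)} {Φ : Idx → (ι → ℝ) → ℝ} [DecidableEq ι]
    (h : HasNet X f Ω Φ) : ∃ g : ι → (ι → RC ρ) → RC ρ,
      ∀ j, HasNet X (g j) Ω fun ε w => fderiv ℝ (Φ ε) w (Pi.single j 1) := by
  choose g hg using fun j => (h.toIsSmoothNet.fderiv_apply (Pi.single j 1)).exists_hasNet
  exact ⟨g, hg⟩

/-- The derivative of a generalized smooth function on `[a,b]` is given by the derivatives of the
functions of a defining net. -/
lemma HasNet.hasNet_dirDeriv (h : HasNet (slab () a b) (fun x => f (x ())) Ω Φ)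
    (hab : RC.Lt a b) :
    (∀ t ∈ RC.interval a b,
      HasDirDeriv (RC.interval a b) f t 1 (dirDeriv (RC.interval a b) f 1 t)) ∧
    HasNet (slab () a b) (fun x => dirDeriv (RC.interval a b) f 1 (x ())) Ω
      fun ε w => fderiv ℝ (Φ ε) w (Pi.single () 1) := by
  obtain ⟨g, hg⟩ := h.exists_partial
  have h1 : ∀ t ∈ RC.interval a b, HasDirDeriv (RC.interval a b) f t 1 (g () fun _ => t) :=
    fun t ht => (h.hasDirDeriv_single hg hab (x := fun _ => t) ht ()).of_slab
  exact ⟨fun t ht => (h1 t ht).hasDirDeriv_dirDeriv,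
    (hg ()).congr fun x hx => ((h1 (x ()) hx).dirDeriv_eq hab hx).symm⟩

lemma IsGSF₁.exists_hasNet (h : IsGSF₁ (RC.interval a b) f) :
    ∃ Ω Φ, HasNet (slab () a b) (fun x => f (x ())) Ω Φ := isGSF_iff_exists_hasNet.1 h

lemma IsGSF₁.hasDirDeriv (h : IsGSF₁ (RC.interval a b) f) (hab : RC.Lt a b)
    (ht : t ∈ RC.interval a b) :
    HasDirDeriv (RC.interval a b) f t 1 (dirDeriv (RC.interval a b) f 1 t) := by
  obtain ⟨Ω, Φ, h⟩ := h.exists_hasNet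
  exact (h.hasNet_dirDeriv hab).1 t ht

lemma IsGSF₁.dirDeriv_interval (h : IsGSF₁ (RC.interval a b) f) (hab : RC.Lt a b) :
    IsGSF₁ (RC.interval a b) (dirDeriv (RC.interval a b) f 1) := by
  obtain ⟨Ω, Φ, h⟩ := h.exists_hasNet
  exact (h.hasNet_dirDeriv hab).2.isGSF

lemma IsGSF₁.congr (h : IsGSF₁ (RC.interval a b) f) (hfg : Set.EqOn f g (RC.interval a b)) :
    IsGSF₁ (RC.interval a b) g := by
  obtain ⟨Ω, Φ, h⟩ := h.exists_hasNet
  exact (h.congr (g := fun x => g (x ())) fun x hx => hfg hx).isGSF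

lemma IsGSF₁.add (hf : IsGSF₁ (RC.interval a b) f) (hg : IsGSF₁ (RC.interval a b) g) :
    IsGSF₁ (RC.interval a b) fun t => f t + g t := by
  obtain ⟨_, _, hf⟩ := hf.exists_hasNet
  obtain ⟨_, _, hg⟩ := hg.exists_hasNet
  exact (hf.add hg).isGSF

lemma IsGSF₁.mul (hf : IsGSF₁ (RC.interval a b) f) (hg : IsGSF₁ (RC.interval a b) g) :
    IsGSF₁ (RC.interval a b) fun t => f t * g t := by
  obtain ⟨_, _, hf⟩ := hf.exists_hasNet
  obtain ⟨_, _, hg⟩ := hg.exists_hasNet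
  exact (hf.mul hg).isGSF

lemma isGSF₁_const (c : RC ρ) : IsGSF₁ (RC.interval a b) fun _ => c := by
  obtain ⟨u, hu⟩ := exists_represents c
  exact (HasNet.const (X := slab () a b) hu).isGSF

lemma isGSF₁_id : IsGSF₁ (RC.interval a b) fun t => t :=
  (HasNet.coord (X := slab () a b) ()).isGSF

lemma IsGSF₁.neg (hf : IsGSF₁ (RC.interval a b) f) : IsGSF₁ (RC.interval a b) fun t => -f t := by
  simpa using (isGSF₁_const (-1)).mul hf

lemma IsGSF₁.sub (hf : IsGSF₁ (RC.interval a b) f) (hg : IsGSF₁ (RC.interval a b) g) :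
    IsGSF₁ (RC.interval a b) fun t => f t - g t := by
  simpa [sub_eq_add_neg] using hf.add hg.neg

lemma IsGSF₁.sum {σ : Type*} (s : Finset σ) {f : σ → RC ρ → RC ρ}
    (hf : ∀ i ∈ s, IsGSF₁ (RC.interval a b) (f i)) :
    IsGSF₁ (RC.interval a b) fun t => ∑ i ∈ s, f i t := by
  classical
  induction s using Finset.induction_on with
  | empty => simpa using isGSF₁_const 0
  | insert i s hi ih =>
    simpa [Finset.sum_insert hi] using (hf i (by simp)).add (ih fun j hj => hf j (by simp [hj]))

lemma IsGSF₁.pow (hf : IsGSF₁ (RC.interval a b) f) (n : ℕ) :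
    IsGSF₁ (RC.interval a b) fun t => f t ^ n := by
  induction n with
  | zero => simpa using isGSF₁_const 1
  | succ n ih => simpa [pow_succ] using ih.mul hf

/-- A generalized smooth function of several variables along generalized smooth functions of one
variable. -/
lemma IsGSF.comp_isGSF₁ {ι : Type*} [Fintype ι] {X : Set (ι → RC ρ)} {L : (ι → RC ρ) → RC ρ}
    (hL : IsGSF X L) {g : RC ρ → ι → RC ρ}
    (hg : ∀ i, IsGSF₁ (RC.interval a b) fun t => g t i) (hm : ∀ t ∈ RC.interval a b, g t ∈ X) :
    IsGSF₁ (RC.interval a b) fun t => L (g t) := by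
  obtain ⟨Ω, Φ, hL⟩ := isGSF_iff_exists_hasNet.1 hL
  choose Θ Ψ hg using fun i => (hg i).exists_hasNet
  exact (hL.comp (Y := slab () a b) (g := fun i y => g (y ()) i) hg fun y hy => hm _ hy).isGSF

section Rules

variable (hab : RC.Lt a b) (ht : t ∈ RC.interval a b)
include hab ht

lemma dirDeriv_add (hf : IsGSF₁ (RC.interval a b) f) (hg : IsGSF₁ (RC.interval a b) g) :
    dirDeriv (RC.interval a b) (fun t => f t + g t) 1 t =
      dirDeriv (RC.interval a b) f 1 t + dirDeriv (RC.interval a b) g 1 t := by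
  obtain ⟨Ω, Φ, hf⟩ := hf.exists_hasNet
  obtain ⟨Θ, Ψ, hg⟩ := hg.exists_hasNet
  obtain ⟨u, hu⟩ := exists_representsPt fun _ : Unit => t
  have h := ((hf.add hg).hasNet_dirDeriv (f := fun t => f t + g t) hab).2.represents _ ht u hu
  refine h.unique ((((hf.hasNet_dirDeriv hab).2.represents _ ht u hu).add
    ((hg.hasNet_dirDeriv hab).2.represents _ ht u hu)).congr ?_)
  filter_upwards [hf.subset ht u hu, hg.subset ht u hu] with ε h1 h2
  rw [((hf.hasFDerivAt h1).fun_add (hg.hasFDerivAt h2)).fderiv]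
  rfl

lemma dirDeriv_mul (hf : IsGSF₁ (RC.interval a b) f) (hg : IsGSF₁ (RC.interval a b) g) :
    dirDeriv (RC.interval a b) (fun t => f t * g t) 1 t =
      f t * dirDeriv (RC.interval a b) g 1 t + dirDeriv (RC.interval a b) f 1 t * g t := by
  obtain ⟨Ω, Φ, hf⟩ := hf.exists_hasNet
  obtain ⟨Θ, Ψ, hg⟩ := hg.exists_hasNet
  obtain ⟨u, hu⟩ := exists_representsPt fun _ : Unit => t
  have h := ((hf.mul hg).hasNet_dirDeriv (f := fun t => f t * g t) hab).2.represents _ ht u hu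
  refine h.unique ((((hf.represents _ ht u hu).mul
    ((hg.hasNet_dirDeriv hab).2.represents _ ht u hu)).add
    (((hf.hasNet_dirDeriv hab).2.represents _ ht u hu).mul (hg.represents _ ht u hu))).congr ?_)
  filter_upwards [hf.subset ht u hu, hg.subset ht u hu] with ε h1 h2
  rw [((hf.hasFDerivAt h1).fun_mul (hg.hasFDerivAt h2)).fderiv]
  simp [mul_comm]

lemma dirDeriv_const (c : RC ρ) : dirDeriv (RC.interval a b) (fun _ => c) 1 t = 0 := by
  obtain ⟨v, hv⟩ := exists_represents c
  obtain ⟨u, hu⟩ := exists_representsPt fun _ : Unit => t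
  have h := ((HasNet.const (X := slab () a b) hv).hasNet_dirDeriv
    (f := fun _ => c) hab).2.represents _ ht u hu
  exact h.unique (by simpa using Represents.zero)

lemma dirDeriv_id : dirDeriv (RC.interval a b) (fun t => t) 1 t = 1 := by
  obtain ⟨u, hu⟩ := exists_representsPt fun _ : Unit => t
  have h := ((HasNet.coord (X := slab () a b) ()).hasNet_dirDeriv
    (f := fun t => t) hab).2.represents _ ht u hu
  refine h.unique (Represents.one.congr (Eventually.of_forall fun ε => ?_))
  have : (fun w : Unit → ℝ => w ()) = ContinuousLinearMap.proj (R := ℝ) (φ := fun _ => ℝ) () := rfl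
  rw [this, ContinuousLinearMap.fderiv]
  simp

lemma dirDeriv_const_mul (c : RC ρ) (hf : IsGSF₁ (RC.interval a b) f) :
    dirDeriv (RC.interval a b) (fun t => c * f t) 1 t = c * dirDeriv (RC.interval a b) f 1 t := by
  rw [dirDeriv_mul hab ht (isGSF₁_const c) hf, dirDeriv_const hab ht, zero_mul, add_zero]

lemma dirDeriv_sub (hf : IsGSF₁ (RC.interval a b) f) (hg : IsGSF₁ (RC.interval a b) g) :
    dirDeriv (RC.interval a b) (fun t => f t - g t) 1 t =
      dirDeriv (RC.interval a b) f 1 t - dirDeriv (RC.interval a b) g 1 t := by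
  have h1 := dirDeriv_add hab ht hf ((isGSF₁_const (-1)).mul hg)
  rw [dirDeriv_const_mul hab ht _ hg] at h1
  simpa [sub_eq_add_neg] using h1

lemma dirDeriv_sum {σ : Type*} (s : Finset σ) {f : σ → RC ρ → RC ρ}
    (hf : ∀ i ∈ s, IsGSF₁ (RC.interval a b) (f i)) :
    dirDeriv (RC.interval a b) (fun t => ∑ i ∈ s, f i t) 1 t =
      ∑ i ∈ s, dirDeriv (RC.interval a b) (f i) 1 t := by
  classical
  induction s using Finset.induction_on with
  | empty => simpa using dirDeriv_const hab ht 0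
  | insert i s hi ih =>
    have h1 := dirDeriv_add hab ht (hf i (by simp))
      (IsGSF₁.sum s fun j hj => hf j (by simp [hj]))
    rw [ih fun j hj => hf j (by simp [hj])] at h1
    simpa [Finset.sum_insert hi] using h1

lemma dirDeriv_pow_succ (hf : IsGSF₁ (RC.interval a b) f) (n : ℕ) :
    dirDeriv (RC.interval a b) (fun t => f t ^ (n + 1)) 1 t =
      (n + 1) * f t ^ n * dirDeriv (RC.interval a b) f 1 t := by
  induction n with
  | zero => simp
  | succ n ih =>
    have h1 := dirDeriv_mul hab ht (hf.pow (n + 1)) hf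
    rw [ih] at h1
    simp only [← pow_succ] at h1
    rw [h1]
    push_cast
    ring

end Rules

/-! ### Mean value inequality -/

lemma HasNet.hasDerivAt {ε : Idx} {s : ℝ} (h : HasNet (slab () a b) (fun x => f (x ())) Ω Φ)
    (hs : (fun _ => s) ∈ Ω ε) : HasDerivAt (fun r : ℝ => Φ ε fun _ => r)
      (fderiv ℝ (Φ ε) (fun _ => s) (Pi.single () 1)) s := by
  have h1 : HasDerivAt (fun r : ℝ => (fun _ : Unit => r)) (Pi.single () 1) s :=
    hasDerivAt_pi.2 fun i => by cases i; simpa using hasDerivAt_id' s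
  exact HasFDerivAt.comp_hasDerivAt s (h.hasFDerivAt hs) h1

/-- Mean value inequality: a lower bound of the derivative is a lower bound of the slopes. -/
lemma IsGSF₁.mul_sub_le (hG : IsGSF₁ (RC.interval a b) G) (hab : RC.Lt a b) {κ x y : RC ρ}
    (hκ : ∀ t ∈ RC.interval a b, RC.Le κ (dirDeriv (RC.interval a b) G 1 t))
    (hx : x ∈ RC.interval a b) (hy : y ∈ RC.interval a b) (hxy : RC.Le x y) :
    RC.Le (κ * (y - x)) (G y - G x) := by
  obtain ⟨α, β, he⟩ := exists_isEndpoints hab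
  obtain ⟨Ω, Φ, h⟩ := hG.exists_hasNet
  obtain ⟨k, hk⟩ := exists_represents κ
  obtain ⟨u, hu, hum⟩ := he.exists_represents hx
  obtain ⟨v', hv', hvm'⟩ := he.exists_represents hy
  -- A representative of `y` in the interval that lies above `u`.
  let v : Idx → ℝ := fun ε => max (u ε) (v' ε)
  have hv : Represents v y := hv'.of_isNegligible_sub fun n => by
    filter_upwards [(RC.le_iff hu hv').1 hxy n] with ε h1
    have := ρ.pow_pos n ε
    rcases max_cases (u ε) (v' ε) with h | h <;> simp only [v, h.1] <;> rw [abs_le] <;>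
      constructor <;> linarith
  have hvm : ∀ ε, v ε ∈ Set.Icc (α ε) (β ε) := fun ε =>
    ⟨(hum ε).1.trans (le_max_left _ _), max_le (hum ε).2 (hvm' ε).2⟩
  have huv : ∀ ε, u ε ≤ v ε := fun ε => le_max_left _ _
  have hne : ∀ ε, (Set.Icc (α ε) (β ε)).Nonempty := fun ε => ⟨_, le_rfl, he.le ε⟩
  have hpt : ∀ w : Idx → ℝ, (∀ ε, w ε ∈ Set.Icc (α ε) (β ε)) →
      ∃ s ∈ RC.interval a b, RepresentsPt (fun ε (_ : Unit) => w ε) fun _ => s := fun w hw => by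
    obtain ⟨s, hs⟩ := (he.isModerate_of_mem hw).exists_represents
    exact ⟨s, he.mem_interval hs (Eventually.of_forall hw), fun _ => hs⟩
  have hΩ := eventually_forall_mem_of_nets hne (P := fun ε s => (fun _ => s) ∈ Ω ε)
    fun w hw => by
      obtain ⟨s, hs, hws⟩ := hpt w hw
      exact h.subset hs _ hws
  have hD : ∀ n : ℕ, ∀ᶠ ε in atBot, ∀ s ∈ Set.Icc (α ε) (β ε),
      k ε ≤ fderiv ℝ (Φ ε) (fun _ => s) (Pi.single () 1) + ρ ε ^ n := fun n =>
    eventually_forall_mem_of_nets hne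
      (P := fun ε s => k ε ≤ fderiv ℝ (Φ ε) (fun _ => s) (Pi.single () 1) + ρ ε ^ n)
      fun w hw => by
        obtain ⟨s, hs, hws⟩ := hpt w hw
        exact (RC.le_iff hk ((h.hasNet_dirDeriv hab).2.represents _ hs _ hws)).1 (hκ s hs) n
  obtain ⟨K, hK⟩ := (hv.sub hu).isModerate
  refine (RC.le_iff (hk.mul (hv.sub hu)) ((h.represents (fun _ => y) hy (fun ε _ => v ε)
    fun _ => hv).sub (h.represents (fun _ => x) hx (fun ε _ => u ε) fun _ => hu))).2 fun n => ?_
  filter_upwards [hΩ, hD (K + n), hK] with ε h1 h2 h3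
  have hsub : Set.Icc (u ε) (v ε) ⊆ Set.Icc (α ε) (β ε) :=
    Set.Icc_subset_Icc (hum ε).1 (hvm ε).2
  have hder : ∀ s ∈ Set.Icc (u ε) (v ε), HasDerivAt (fun r : ℝ => Φ ε fun _ => r)
      (fderiv ℝ (Φ ε) (fun _ => s) (Pi.single () 1)) s := fun s hs =>
    h.hasDerivAt (h1 s (hsub hs))
  have h4 := (convex_Icc (u ε) (v ε)).mul_sub_le_image_sub_of_le_deriv
    (f := fun r : ℝ => Φ ε fun _ => r)
    (fun s hs => (hder s hs).continuousAt.continuousWithinAt)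
    (fun s hs => (hder s (interior_subset hs)).differentiableAt.differentiableWithinAt)
    (C := k ε - ρ ε ^ (K + n))
    (fun s hs => by
      rw [(hder s (interior_subset hs)).deriv]
      linarith [h2 s (hsub (interior_subset hs))])
    (u ε) ⟨le_rfl, huv ε⟩ (v ε) ⟨huv ε, le_rfl⟩ (huv ε)
  have h5 : ρ ε ^ (K + n) * (v ε - u ε) ≤ ρ ε ^ n := by
    calc ρ ε ^ (K + n) * (v ε - u ε) ≤ ρ ε ^ (K + n) * (ρ ε ^ K)⁻¹ :=
          mul_le_mul_of_nonneg_left ((le_abs_self _).trans h3) (ρ.pow_pos _ ε).le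
      _ = ρ ε ^ n := by
          rw [pow_add, mul_right_comm, mul_inv_cancel₀ (ρ.pow_pos K ε).ne', one_mul]
  linarith [sub_mul (k ε) (ρ ε ^ (K + n)) (v ε - u ε)]

end OneVariable

/-! ### Primitives -/

lemma RC.abs_le_iff {x y : RC ρ} : RC.Le (RC.abs x) y ↔ RC.Le (-y) x ∧ RC.Le x y := by
  obtain ⟨u, hu⟩ := exists_represents x
  obtain ⟨v, hv⟩ := exists_represents y
  rw [RC.le_iff hu.abs hv, RC.le_iff hv.neg hu, RC.le_iff hu hv]
  refine ⟨fun h => ⟨fun n => (h n).mono fun ε hε => ?_, fun n => (h n).mono fun ε hε => ?_⟩,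
    fun h n => ?_⟩
  · linarith [(abs_le.1 hε).1]
  · linarith [(abs_le.1 hε).2]
  · filter_upwards [h.1 n, h.2 n] with ε h1 h2
    rw [abs_le]
    constructor <;> linarith

lemma RC.neg_le_neg {x y : RC ρ} (h : RC.Le x y) : RC.Le (-y) (-x) := by
  obtain ⟨u, v, hu, hv, h⟩ := h
  exact ⟨_, _, hv.neg, hu.neg, fun ε => by simpa using h ε⟩

section Primitive

variable {a b : RC ρ} {f g F G : RC ρ → RC ρ}

lemma IsGSF₁.eq_left_of_dirDeriv_eq_zero (hG : IsGSF₁ (RC.interval a b) G) (hab : RC.Lt a b)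
    (h0 : ∀ t ∈ RC.interval a b, dirDeriv (RC.interval a b) G 1 t = 0) {x : RC ρ}
    (hx : x ∈ RC.interval a b) : G x = G a := by
  obtain ⟨α, β, he⟩ := exists_isEndpoints hab
  have key : ∀ {H : RC ρ → RC ρ}, IsGSF₁ (RC.interval a b) H →
      (∀ t ∈ RC.interval a b, dirDeriv (RC.interval a b) H 1 t = 0) → RC.Le 0 (H x - H a) :=
    fun hH h0 => by
      simpa using hH.mul_sub_le hab (κ := 0) (fun t ht => h0 t ht ▸ RC.le_refl 0)
        he.left_mem hx hx.1
  have h1 := key hG h0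
  have h2 := key ((isGSF₁_const (-1)).mul hG) fun t ht => by
    rw [dirDeriv_const_mul hab ht _ hG, h0 t ht, mul_zero]
  refine sub_eq_zero.1 (RC.le_antisymm ?_ h1)
  have h3 := RC.neg_le_neg h2
  ring_nf at h3 ⊢
  exact h3

lemma IsPrimitive.eqOn (hF : IsPrimitive a b a f F) (hG : IsPrimitive a b a g G)
    (hab : RC.Lt a b) (hfg : Set.EqOn f g (RC.interval a b)) :
    Set.EqOn F G (RC.interval a b) := fun x hx => by
  have h1 := (hF.1.sub hG.1).eq_left_of_dirDeriv_eq_zero hab (fun t ht => by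
    rw [dirDeriv_sub hab ht hF.1 hG.1, (hF.2.2 t ht).dirDeriv_eq hab ht,
      (hG.2.2 t ht).dirDeriv_eq hab ht, hfg ht, sub_self]) hx
  rw [hF.2.1, hG.2.1, sub_zero] at h1
  exact sub_eq_zero.1 h1

lemma isOpen_ordConnectedComponent {s : Set ℝ} (hs : IsOpen s) (x : ℝ) :
    IsOpen (s.ordConnectedComponent x) := by
  refine isOpen_iff_mem_nhds.2 fun y hy => ?_
  rw [Set.ordConnectedComponent_eq hy]
  exact Set.ordConnectedComponent_mem_nhds.2
    (hs.mem_nhds (Set.ordConnectedComponent_subset hy))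

/-- Every generalized smooth function on `[a,b]` has a primitive. A net of primitives is defined
on the connected components of the domains that contain the left end point. -/
lemma IsGSF₁.exists_isPrimitive (hf : IsGSF₁ (RC.interval a b) f) (hab : RC.Lt a b) :
    ∃ F, IsPrimitive a b a f F := by
  obtain ⟨α, β, he⟩ := exists_isEndpoints hab
  obtain ⟨Ω, Φ, h⟩ := hf.exists_hasNet
  let S : Idx → Set ℝ := fun ε => {s | (fun _ => s) ∈ Ω ε}
  let φ : Idx → ℝ → ℝ := fun ε s => Φ ε fun _ => s
  let pr : (Unit → ℝ) →L[ℝ] ℝ := ContinuousLinearMap.proj (R := ℝ) (φ := fun _ : Unit => ℝ) ()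
  let Ω' : Idx → Set (Unit → ℝ) := fun ε => {w | w () ∈ (S ε).ordConnectedComponent (α ε)}
  let P : Idx → (Unit → ℝ) → ℝ := fun ε w => ∫ s in (α ε)..(w ()), φ ε s
  have hS : ∀ ε, IsOpen (S ε) := fun ε =>
    (h.isOpen ε).preimage (continuous_pi fun _ => continuous_id)
  have hφ : ∀ ε, ContinuousOn (φ ε) (S ε) := fun ε s hs =>
    (h.hasDerivAt hs).continuousAt.continuousWithinAt
  have hopen : ∀ ε, IsOpen (Ω' ε) := fun ε =>
    (isOpen_ordConnectedComponent (hS ε) (α ε)).preimage (continuous_apply ())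
  have hΩ' : ∀ ε, Ω' ε ⊆ Ω ε := fun ε w hw => hw Set.right_mem_uIcc
  have hder : ∀ ε, ∀ w ∈ Ω' ε, HasFDerivAt (P ε) (Φ ε w • pr) w := by
    intro ε w hw
    have hsub : Set.uIcc (α ε) (w ()) ⊆ S ε := hw
    have hwS : w () ∈ S ε := hsub Set.right_mem_uIcc
    have h1 : HasDerivAt (fun r => ∫ s in (α ε)..r, φ ε s) (φ ε (w ())) (w ()) :=
      intervalIntegral.integral_hasDerivAt_right
        (((hφ ε).mono hsub).intervalIntegrable)
        ((hφ ε).stronglyMeasurableAtFilter (hS ε) _ hwS)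
        ((hφ ε).continuousAt ((hS ε).mem_nhds hwS))
    exact h1.comp_hasFDerivAt w pr.hasFDerivAt
  have hfd : ∀ ε, ∀ w ∈ Ω' ε, fderiv ℝ (P ε) w =
      ((ContinuousLinearMap.toSpanSingleton ℝ pr) ∘ Φ ε) w := fun ε w hw => by
    rw [(hder ε w hw).fderiv]
    simp
  have hsmooth : ∀ ε, ContDiffOn ℝ ∞ (P ε) (Ω' ε) := fun ε => by
    rw [contDiffOn_infty_iff_fderiv_of_isOpen (hopen ε)]
    refine ⟨fun w hw => (hder ε w hw).differentiableAt.differentiableWithinAt, ?_⟩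
    exact (((ContinuousLinearMap.toSpanSingleton ℝ pr).contDiff.comp_contDiffOn
      ((h.contDiffOn ε).mono (hΩ' ε)))).congr (hfd ε)
  -- Along a representative, the interval that starts at the left end point is in the domain, with
  -- a moderate bound of the integrand.
  have hbound : ∀ x ∈ slab () a b, ∀ u : Idx → Unit → ℝ, RepresentsPt u x →
      ∃ N : ℕ, ∀ᶠ ε in atBot, ∀ s ∈ Set.uIcc (α ε) (u ε ()),
        s ∈ S ε ∧ |φ ε s| ≤ (ρ ε ^ N)⁻¹ := by
    intro x hx u hu
    obtain ⟨z, hz, hzm⟩ := he.exists_represents hx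
    have hz' : RepresentsPt (fun ε (_ : Unit) => z ε) x := fun _ => hz
    obtain ⟨N₁, h₁⟩ := h.exists_bound_segment hx hz' hu 0
    obtain ⟨A, hA⟩ := (he.right.isModerate.sub he.left.isModerate)
    obtain ⟨N₂, h₂⟩ := h.exists_bound_netBox he A 0
    refine ⟨N₁ + N₂, ?_⟩
    filter_upwards [h₁, h₂, hA] with ε h1 h2 h3 s hs
    rcases Set.uIcc_subset_uIcc_union_uIcc (b := z ε) hs with hs | hs
    · have hs' : s ∈ Set.Icc (α ε) (z ε) := by rwa [Set.uIcc_of_le (hzm ε).1] at hs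
      have hs2 : (fun _ => s) ∈ netBox ρ α β () A ε := by
        refine ⟨⟨hs'.1, hs'.2.trans (hzm ε).2⟩, ?_⟩
        rw [mem_closedBall_iff_norm, pi_norm_le_iff_of_nonneg (inv_nonneg.2 (ρ.pow_pos _ ε).le)]
        intro _
        refine le_trans ?_ h3
        simp only [Pi.sub_apply, Real.norm_eq_abs]
        rw [abs_of_nonneg (by linarith [hs'.1])]
        exact le_trans (by linarith [hs'.2, (hzm ε).2]) (le_abs_self _)
      refine ⟨(h2 _ hs2).1, ?_⟩
      have := (h2 _ hs2).2
      rw [norm_iteratedFDeriv_zero] at this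
      exact this.trans (inv_pow_le_inv_pow ε (by omega))
    · have hs2 : (fun _ => s) ∈ segment ℝ (fun _ : Unit => z ε) (u ε) := by
        rw [← segment_eq_uIcc] at hs
        obtain ⟨p, r, hp, hr, hpr, hs⟩ := hs
        exact ⟨p, r, hp, hr, hpr, funext fun _ => hs⟩
      refine ⟨(h1 _ hs2).1, ?_⟩
      have := (h1 _ hs2).2
      rw [norm_iteratedFDeriv_zero] at this
      exact this.trans (inv_pow_le_inv_pow ε (by omega))
  have hnet : IsSmoothNet (slab () a b) Ω' P := by
    refine ⟨hopen, hsmooth, fun x hx u hu => ?_, fun x hx u hu k => ?_⟩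
    · obtain ⟨N, hN⟩ := hbound x hx u hu
      exact hN.mono fun ε hε s hs => (hε s hs).1
    · obtain ⟨N, hN⟩ := hbound x hx u hu
      match k with
      | 0 =>
        refine ((isModerate_inv_pow N).mul
          ((hu ()).isModerate.sub he.left.isModerate)).of_le ?_
        filter_upwards [hN] with ε hε
        have := intervalIntegral.norm_integral_le_of_norm_le_const (f := φ ε)
          (fun s hs => (hε s (Set.uIoc_subset_uIcc hs)).2)
        rw [norm_iteratedFDeriv_zero, abs_of_nonneg (norm_nonneg _), Pi.mul_apply, abs_mul,
          abs_of_nonneg (inv_nonneg.2 (ρ.pow_pos N ε).le)]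
        exact this
      | k + 1 =>
        refine ((isModerate_const ‖ContinuousLinearMap.toSpanSingleton ℝ pr‖).mul
          (h.moderate x hx u hu k)).of_le ?_
        filter_upwards [hN, h.subset hx u hu] with ε hε hε'
        have hw : u ε ∈ Ω' ε := fun s hs => (hε s hs).1
        have heq : fderiv ℝ (P ε) =ᶠ[𝓝 (u ε)] (ContinuousLinearMap.toSpanSingleton ℝ pr) ∘ Φ ε :=
          Filter.eventually_of_mem ((hopen ε).mem_nhds hw) (hfd ε)
        have h1 := (ContinuousLinearMap.toSpanSingleton ℝ pr).norm_iteratedFDeriv_comp_left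
          (n := k) (h.contDiffAt hε') (by exact_mod_cast le_top)
        rw [← (heq.iteratedFDeriv ℝ k).eq_of_nhds, norm_iteratedFDeriv_fderiv] at h1
        simpa [abs_mul] using h1
  obtain ⟨F, hF⟩ := hnet.exists_hasNet
  have hF' : HasNet (slab () a b) (fun x => (fun t => F fun _ => t) (x ())) Ω' P := hF
  refine ⟨fun t => F fun _ => t, hF'.isGSF, ?_, fun t ht => ?_⟩
  · exact (hF.represents (fun _ => a) he.left_mem (fun ε _ => α ε) fun _ => he.left).unique
      (by simpa [P] using Represents.zero)
  · obtain ⟨h1, h2⟩ := hF'.hasNet_dirDeriv (f := fun t => F fun _ => t) hab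
    obtain ⟨u, hu⟩ := exists_representsPt fun _ : Unit => t
    have h3 := (h2.represents (fun _ => t) ht u hu).unique
      ((h.represents (fun _ => t) ht u hu).congr (by
        filter_upwards [hF.subset ht u hu] with ε hε
        rw [(hder ε _ hε).fderiv]
        simp [pr]))
    simpa only [h3] using h1 t ht

lemma IsGSF₁.isPrimitive_primitive (hf : IsGSF₁ (RC.interval a b) f) (hab : RC.Lt a b) :
    IsPrimitive a b a f (primitive a b a f) := by
  have h := hf.exists_isPrimitive hab
  rw [primitive, dif_pos h]
  exact h.choose_spec

/-- A generalized smooth function on `[a,b]` is bounded. -/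
lemma IsGSF₁.exists_boundedBy (hf : IsGSF₁ (RC.interval a b) f) (hab : RC.Lt a b) :
    ∃ K, ∀ t ∈ RC.interval a b, RC.BoundedBy K (f t) := by
  obtain ⟨α, β, he⟩ := exists_isEndpoints hab
  obtain ⟨Ω, Φ, h⟩ := hf.exists_hasNet
  have hne : ∀ ε, (Set.Icc (α ε) (β ε)).Nonempty := fun ε => ⟨_, le_rfl, he.le ε⟩
  obtain ⟨N, hN⟩ := exists_uniform_bound_of_nets (ρ := ρ) hne (g := fun ε s => Φ ε fun _ => s)
    fun w hw => by
      obtain ⟨s, hs⟩ := (he.isModerate_of_mem hw).exists_represents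
      exact h.isModerate (x := fun _ => s)
        (he.mem_interval hs (Eventually.of_forall hw)) fun _ => hs
  refine ⟨N, fun t ht => ?_⟩
  obtain ⟨u, hu, hum⟩ := he.exists_represents ht
  exact ⟨_, h.represents (fun _ => t) ht (fun ε _ => u ε) fun _ => hu,
    hN.mono fun ε hε => hε _ (hum ε)⟩

end Primitive

/-! ### Iterated derivatives and iterated integrals -/

section Iterated

variable {a b t : RC ρ} {f g : RC ρ → RC ρ}

lemma iterDeriv_succ (X : Set (RC ρ)) (n : ℕ) (f : RC ρ → RC ρ) :
    iterDeriv X (n + 1) f = dirDeriv X (iterDeriv X n f) 1 :=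
  Function.iterate_succ_apply' _ _ _

lemma iterDeriv_succ' (X : Set (RC ρ)) (n : ℕ) (f : RC ρ → RC ρ) :
    iterDeriv X (n + 1) f = iterDeriv X n (dirDeriv X f 1) :=
  Function.iterate_succ_apply _ _ _

lemma iterInt_succ (n : ℕ) (f : RC ρ → RC ρ) :
    iterInt a b (n + 1) f = primitive a b a (iterInt a b n f) :=
  Function.iterate_succ_apply' _ _ _

lemma iterDeriv_congr (h : Set.EqOn f g (RC.interval a b)) (n : ℕ) :
    Set.EqOn (iterDeriv (RC.interval a b) n f) (iterDeriv (RC.interval a b) n g)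
      (RC.interval a b) := by
  induction n with
  | zero => exact h
  | succ n ih => simpa only [iterDeriv_succ] using dirDeriv_congr ih

lemma IsGSF₁.iterDeriv_interval (hf : IsGSF₁ (RC.interval a b) f) (hab : RC.Lt a b) (n : ℕ) :
    IsGSF₁ (RC.interval a b) (iterDeriv (RC.interval a b) n f) := by
  induction n with
  | zero => exact hf
  | succ n ih => rw [iterDeriv_succ]; exact ih.dirDeriv_interval hab

lemma IsGSF₁.isPrimitive_iterInt (hf : IsGSF₁ (RC.interval a b) f) (hab : RC.Lt a b) (n : ℕ) :
    IsPrimitive a b a (iterInt a b n f) (iterInt a b (n + 1) f) := by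
  induction n with
  | zero => exact hf.isPrimitive_primitive hab
  | succ n ih =>
    rw [iterInt_succ (n + 1)]
    exact ih.1.isPrimitive_primitive hab

lemma IsGSF₁.iterInt_interval (hf : IsGSF₁ (RC.interval a b) f) (hab : RC.Lt a b) (n : ℕ) :
    IsGSF₁ (RC.interval a b) (iterInt a b n f) := by
  cases n with
  | zero => exact hf
  | succ n => exact (hf.isPrimitive_iterInt hab n).1

lemma iterDeriv_add_iterInt (hf : IsGSF₁ (RC.interval a b) f) (hab : RC.Lt a b) (i n : ℕ) :
    Set.EqOn (iterDeriv (RC.interval a b) (i + n) (iterInt a b n f))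
      (iterDeriv (RC.interval a b) i f) (RC.interval a b) := by
  induction n with
  | zero => exact fun _ _ => rfl
  | succ n ih =>
    intro t ht
    rw [← add_assoc, iterDeriv_succ', ← ih ht]
    exact iterDeriv_congr (fun s hs =>
      ((hf.isPrimitive_iterInt hab n).2.2 s hs).dirDeriv_eq hab hs) _ ht

section Rules

variable (hab : RC.Lt a b)
include hab

lemma iterDeriv_const_mul (c : RC ρ) (hf : IsGSF₁ (RC.interval a b) f) (n : ℕ)
    (ht : t ∈ RC.interval a b) :
    iterDeriv (RC.interval a b) n (fun t => c * f t) t =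
      c * iterDeriv (RC.interval a b) n f t := by
  induction n generalizing t with
  | zero => rfl
  | succ n ih =>
    rw [iterDeriv_succ, iterDeriv_succ,
      ← dirDeriv_const_mul hab ht c (hf.iterDeriv_interval hab n)]
    exact dirDeriv_congr (fun s hs => ih hs) ht

lemma iterDeriv_sum {σ : Type*} (s : Finset σ) {f : σ → RC ρ → RC ρ}
    (hf : ∀ i ∈ s, IsGSF₁ (RC.interval a b) (f i)) (n : ℕ) (ht : t ∈ RC.interval a b) :
    iterDeriv (RC.interval a b) n (fun t => ∑ i ∈ s, f i t) t =
      ∑ i ∈ s, iterDeriv (RC.interval a b) n (f i) t := by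
  induction n generalizing t with
  | zero => rfl
  | succ n ih =>
    simp only [iterDeriv_succ]
    rw [← dirDeriv_sum hab ht s fun i hi => (hf i hi).iterDeriv_interval hab n]
    exact dirDeriv_congr (fun s hs => ih hs) ht

lemma iterDeriv_add (hf : IsGSF₁ (RC.interval a b) f) (hg : IsGSF₁ (RC.interval a b) g) (n : ℕ)
    (ht : t ∈ RC.interval a b) :
    iterDeriv (RC.interval a b) n (fun t => f t + g t) t =
      iterDeriv (RC.interval a b) n f t + iterDeriv (RC.interval a b) n g t := by
  induction n generalizing t with
  | zero => rfl
  | succ n ih =>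
    simp only [iterDeriv_succ]
    rw [← dirDeriv_add hab ht (hf.iterDeriv_interval hab n) (hg.iterDeriv_interval hab n)]
    exact dirDeriv_congr (fun s hs => ih hs) ht

/-- Derivatives of order `i` of a multiple of `z ^ (i + j)` are multiples of `z ^ j`. -/
lemma exists_iterDeriv_pow_mul {z : RC ρ → RC ρ} (hz : IsGSF₁ (RC.interval a b) z)
    (hg : IsGSF₁ (RC.interval a b) g) (i j : ℕ) :
    ∃ g', IsGSF₁ (RC.interval a b) g' ∧
      Set.EqOn (iterDeriv (RC.interval a b) i fun t => z t ^ (i + j) * g t)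
        (fun t => z t ^ j * g' t) (RC.interval a b) := by
  induction i generalizing j with
  | zero => exact ⟨g, hg, fun t ht => by simp [iterDeriv]⟩
  | succ i ih =>
    obtain ⟨g', hg', h⟩ := ih (j + 1)
    refine ⟨fun t => z t * dirDeriv (RC.interval a b) g' 1 t +
      (j + 1) * dirDeriv (RC.interval a b) z 1 t * g' t,
      (hz.mul (hg'.dirDeriv_interval hab)).add
        (((isGSF₁_const _).mul (hz.dirDeriv_interval hab)).mul hg'), fun t ht => ?_⟩
    have e : i + 1 + j = i + (j + 1) := by omega
    rw [iterDeriv_succ, e, dirDeriv_congr h ht, dirDeriv_mul hab ht (hz.pow (j + 1)) hg',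
      dirDeriv_pow_succ hab ht hz]
    ring

/-- Repeated integration by parts: if the derivatives of `h` of order less than `n` vanish at the
end points, then `φ h⁽ⁿ⁾ - (-1)ⁿ φ⁽ⁿ⁾ h` has a primitive that vanishes at both of them. -/
lemma exists_primitive_by_parts {φ h : RC ρ → RC ρ} (hφ : IsGSF₁ (RC.interval a b) φ)
    (hh : IsGSF₁ (RC.interval a b) h) (n : ℕ)
    (h0 : ∀ j < n, iterDeriv (RC.interval a b) j h a = 0 ∧
      iterDeriv (RC.interval a b) j h b = 0) :
    ∃ B, IsGSF₁ (RC.interval a b) B ∧ B a = 0 ∧ B b = 0 ∧ ∀ t ∈ RC.interval a b,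
      dirDeriv (RC.interval a b) B 1 t = φ t * iterDeriv (RC.interval a b) n h t -
        (-1) ^ n * iterDeriv (RC.interval a b) n φ t * h t := by
  induction n generalizing φ with
  | zero =>
    refine ⟨fun _ => 0, isGSF₁_const 0, rfl, rfl, fun t ht => ?_⟩
    rw [dirDeriv_const hab ht]
    simp [iterDeriv]
  | succ n ih =>
    obtain ⟨B, hB, hBa, hBb, hD⟩ := ih (hφ.dirDeriv_interval hab) fun j hj => h0 j (by omega)
    refine ⟨fun t => φ t * iterDeriv (RC.interval a b) n h t - B t,
      (hφ.mul (hh.iterDeriv_interval hab n)).sub hB, ?_, ?_, fun t ht => ?_⟩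
    · simp [hBa, (h0 n (by omega)).1]
    · simp [hBb, (h0 n (by omega)).2]
    · rw [dirDeriv_sub hab ht (hφ.mul (hh.iterDeriv_interval hab n)) hB,
        dirDeriv_mul hab ht hφ (hh.iterDeriv_interval hab n), hD t ht, ← iterDeriv_succ',
        ← iterDeriv_succ]
      ring

omit hab in
lemma isGSF₁_eval (p : Polynomial (RC ρ)) : IsGSF₁ (RC.interval a b) fun t => p.eval t := by
  simp only [Polynomial.eval_eq_sum_range]
  exact IsGSF₁.sum _ fun i _ => (isGSF₁_const _).mul (isGSF₁_id.pow i)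

omit hab in
lemma RC.exists_mul_natCast_eq_one (n : ℕ) : ∃ c : RC ρ, c * (n + 1) = 1 := by
  have hn : Represents (fun _ => (n : ℝ)) (n : RC ρ) := by
    induction n with
    | zero => simpa using Represents.zero
    | succ n ih => simpa using ih.add Represents.one
  obtain ⟨c, hc⟩ := (isModerate_const (ρ := ρ) (1 / ((n : ℝ) + 1))).exists_represents
  refine ⟨c, (hc.mul (hn.add Represents.one)).unique ?_⟩
  have : 1 / ((n : ℝ) + 1) * ((n : ℝ) + 1) = 1 := by field_simp
  simpa only [this] using Represents.one

lemma exists_polynomial_primitive (p : Polynomial (RC ρ)) :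
    ∃ P : Polynomial (RC ρ), P.natDegree ≤ p.natDegree + 1 ∧
      ∀ t ∈ RC.interval a b, dirDeriv (RC.interval a b) (fun t => P.eval t) 1 t = p.eval t := by
  choose c hc using RC.exists_mul_natCast_eq_one (ρ := ρ)
  refine ⟨∑ i ∈ Finset.range (p.natDegree + 1),
    Polynomial.C (p.coeff i * c i) * Polynomial.X ^ (i + 1), ?_, fun t ht => ?_⟩
  · refine Polynomial.natDegree_sum_le_of_forall_le _ _ fun i hi => ?_
    refine (Polynomial.natDegree_C_mul_X_pow_le _ _).trans ?_
    have := Finset.mem_range.1 hi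
    omega
  · simp only [Polynomial.eval_finsetSum, Polynomial.eval_mul, Polynomial.eval_C,
      Polynomial.eval_pow, Polynomial.eval_X]
    rw [dirDeriv_sum hab ht _ fun i _ => (isGSF₁_const _).mul (isGSF₁_id.pow (i + 1)),
      Polynomial.eval_eq_sum_range]
    refine Finset.sum_congr rfl fun i _ => ?_
    rw [dirDeriv_const_mul hab ht _ (isGSF₁_id.pow (i + 1)), dirDeriv_pow_succ hab ht isGSF₁_id,
      dirDeriv_id hab ht]
    linear_combination p.coeff i * t ^ i * hc i

/-- A generalized smooth function whose derivative of order `n + 1` vanishes is a polynomial. -/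
lemma IsGSF₁.exists_polynomial {S : RC ρ → RC ρ} (hS : IsGSF₁ (RC.interval a b) S) (n : ℕ)
    (h0 : ∀ t ∈ RC.interval a b, iterDeriv (RC.interval a b) (n + 1) S t = 0) :
    ∃ p : Polynomial (RC ρ), p.natDegree ≤ n ∧ ∀ t ∈ RC.interval a b, S t = p.eval t := by
  induction n generalizing S with
  | zero =>
    refine ⟨Polynomial.C (S a), by simp, fun t ht => ?_⟩
    rw [Polynomial.eval_C]
    exact hS.eq_left_of_dirDeriv_eq_zero hab h0 ht
  | succ n ih =>
    obtain ⟨p, hp, hSp⟩ := ih (hS.dirDeriv_interval hab) fun t ht => by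
      rw [← iterDeriv_succ']; exact h0 t ht
    obtain ⟨P, hP, hDP⟩ := exists_polynomial_primitive hab p
    refine ⟨P + Polynomial.C (S a - P.eval a), ?_, fun t ht => ?_⟩
    · exact (Polynomial.natDegree_add_le _ _).trans (max_le (by omega) (by simp))
    · have h1 := (hS.sub (isGSF₁_eval P)).eq_left_of_dirDeriv_eq_zero hab (fun s hs => by
        rw [dirDeriv_sub hab hs hS (isGSF₁_eval P), hDP s hs, hSp s hs, sub_self]) ht
      rw [Polynomial.eval_add, Polynomial.eval_C]
      linear_combination h1

end Rules

/-! ### The fundamental lemma of the calculus of variations -/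

/-- The Robinson–Colombeau ring is reduced. -/
lemma RC.eq_zero_of_mul_self {x : RC ρ} (h : x * x = 0) : x = 0 := by
  obtain ⟨u, hu⟩ := exists_represents x
  refine hu.eq_zero_iff.2 fun n => ?_
  filter_upwards [(hu.mul hu).eq_zero_iff.1 h (n + n)] with ε hε
  rw [abs_mul, pow_add] at hε
  exact abs_le_of_sq_le_sq' (by rw [pow_two, pow_two, ← abs_mul_abs_self]; exact hε)
    (ρ.pow_pos n ε).le |> abs_le.2

/-- A generalized smooth function that vanishes at points arbitrarily close to `t` vanishes
at `t`. -/
lemma IsGSF₁.eq_zero_of_frequently (hf : IsGSF₁ (RC.interval a b) f) (hab : RC.Lt a b)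
    (ht : t ∈ RC.interval a b)
    (h : ∀ n : ℕ, ∃ s, RC.Lt (RC.abs s) (RC.gaugePow ρ n) ∧ t + s ∈ RC.interval a b ∧
      f (t + s) = 0) : f t = 0 := by
  obtain ⟨r, -, ⟨δ, hδ, hr⟩, hc⟩ := hf.hasDirDeriv hab ht
  obtain ⟨δ', hδ', hc⟩ := hc _ (RC.gaugePow_pos 0)
  obtain ⟨N, hN⟩ := RC.exists_lt_of_lt_gaugePow hδ
  obtain ⟨N', hN'⟩ := RC.exists_lt_of_lt_gaugePow hδ'
  obtain ⟨y, hy⟩ := exists_represents (dirDeriv (RC.interval a b) f 1 t)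
  obtain ⟨K, hK⟩ := hy.isModerate
  obtain ⟨u, hu⟩ := exists_represents (f t)
  refine hu.eq_zero_iff.2 fun n => ?_
  obtain ⟨s, hs, hts, hfs⟩ := h (N + N' + K + 1 + n + 1)
  have e1 := hr s (hN _ (by omega) _ hs) (by simpa using hts)
  have e2 := hc s (hN' _ (by omega) _ hs) (by simpa using hts)
  rw [smul_eq_mul, mul_one, hfs] at e1
  obtain ⟨R, hR⟩ := exists_represents (r s)
  obtain ⟨S, hS⟩ := exists_represents s
  obtain ⟨J, hJ⟩ := (RC.lt_iff (hR.sub hy).abs (RC.represents_gaugePow 0)).1 e2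
  obtain ⟨J', hJ'⟩ := (RC.lt_iff hS.abs (RC.represents_gaugePow _)).1 hs
  filter_upwards [hK, hJ, hJ', (hu.add (hS.mul hR)).eq_zero_iff.1 e1.symm (n + 1),
    ρ.eventually_mul_inv_pow_le 2 K, ρ.eventually_mul_pow_succ_le 2 n] with ε a1 a2 a3 a4 a5 a6
  have b1 := ρ.pow_pos J ε
  have b2 := ρ.pow_pos J' ε
  have b3 := ρ.one_le_inv K ε
  rw [pow_zero] at a2
  have b4 : |R ε| ≤ (ρ ε ^ (K + 1))⁻¹ := by
    have : |R ε| ≤ |R ε - y ε| + |y ε| := by simpa using abs_add_le (R ε - y ε) (y ε)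
    linarith
  have b5 : |S ε| ≤ ρ ε ^ (K + 1 + (n + 1)) :=
    le_trans (by linarith) (ρ.pow_anti (show K + 1 + (n + 1) ≤ N + N' + K + 1 + n + 1 by omega) ε)
  have b6 : |S ε * R ε| ≤ ρ ε ^ (n + 1) := by
    rw [abs_mul]
    calc |S ε| * |R ε| ≤ ρ ε ^ (K + 1 + (n + 1)) * (ρ ε ^ (K + 1))⁻¹ :=
          mul_le_mul b5 b4 (abs_nonneg _) (ρ.pow_pos _ ε).le
      _ = ρ ε ^ (n + 1) := by
          rw [pow_add, mul_right_comm, mul_inv_cancel₀ (ρ.pow_pos _ ε).ne', one_mul]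
  have b7 : |u ε| ≤ |u ε + S ε * R ε| + |S ε * R ε| := by
    simpa using abs_sub (u ε + S ε * R ε) (S ε * R ε)
  linarith

/-- A nonnegative generalized smooth function whose integral over `[a,b]` vanishes is zero: its
primitive increases from `0` to `0`. -/
lemma IsPrimitive.eq_zero_of_nonneg {F : RC ρ → RC ρ} (hF : IsPrimitive a b a f F)
    (hab : RC.Lt a b) (h0 : ∀ t ∈ RC.interval a b, RC.Le 0 (f t)) (hb : F b = 0)
    (ht : t ∈ RC.interval a b) : f t = 0 := by
  obtain ⟨α, β, he⟩ := exists_isEndpoints hab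
  have hD : ∀ t ∈ RC.interval a b, dirDeriv (RC.interval a b) F 1 t = f t := fun t ht =>
    (hF.2.2 t ht).dirDeriv_eq hab ht
  have hz : Set.EqOn F (fun _ => 0) (RC.interval a b) := fun s hs => by
    have h1 := hF.1.mul_sub_le hab (κ := 0) (fun t ht => (hD t ht).symm ▸ h0 t ht)
      he.left_mem hs hs.1
    have h2 := hF.1.mul_sub_le hab (κ := 0) (fun t ht => (hD t ht).symm ▸ h0 t ht)
      hs he.right_mem hs.2
    rw [hF.2.1, zero_mul, sub_zero] at h1
    rw [hb, zero_mul, zero_sub] at h2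
    have h3 := RC.neg_le_neg h2
    rw [neg_neg, neg_zero] at h3
    exact RC.le_antisymm h3 h1
  rw [← hD t ht, dirDeriv_congr hz ht, dirDeriv_const hab ht]

/-- Fundamental lemma of the calculus of variations. The test function
`((t - a) (b - t)) ^ m * E t` makes the integrand nonnegative. -/
lemma IsGSF₁.eq_zero_of_forall_integral_mul_eq_zero {E : RC ρ → RC ρ}
    (hE : IsGSF₁ (RC.interval a b) E) (hab : RC.Lt a b) (m : ℕ)
    (h0 : ∀ h, IsGSF₁ (RC.interval a b) h →
      (∀ i < m, iterDeriv (RC.interval a b) i h a = 0 ∧ iterDeriv (RC.interval a b) i h b = 0) →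
      primitive a b a (fun t => E t * h t) b = 0) (ht : t ∈ RC.interval a b) : E t = 0 := by
  obtain ⟨α, β, he⟩ := exists_isEndpoints hab
  let z : RC ρ → RC ρ := fun t => (t - a) * (b - t)
  have hz : IsGSF₁ (RC.interval a b) z :=
    (isGSF₁_id.sub (isGSF₁_const a)).mul ((isGSF₁_const b).sub isGSF₁_id)
  have hh : IsGSF₁ (RC.interval a b) fun t => z t ^ m * E t := (hz.pow m).mul hE
  have hv : ∀ i < m, iterDeriv (RC.interval a b) i (fun t => z t ^ m * E t) a = 0 ∧
      iterDeriv (RC.interval a b) i (fun t => z t ^ m * E t) b = 0 := fun i hi => by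
    obtain ⟨j, rfl⟩ : ∃ j, m = i + (j + 1) := ⟨m - i - 1, by omega⟩
    obtain ⟨g', -, hg'⟩ := exists_iterDeriv_pow_mul hab hz hE i (j + 1)
    rw [hg' he.left_mem, hg' he.right_mem]
    simp [z]
  have hP := (hE.mul hh).isPrimitive_primitive hab
  have key : ∀ t ∈ RC.interval a b, E t * (z t ^ m * E t) = 0 := fun t ht => by
    refine hP.eq_zero_of_nonneg hab (fun s hs => ?_) (h0 _ hh hv) ht
    obtain ⟨u, hu, hum⟩ := he.exists_represents hs
    obtain ⟨e, hEe⟩ := exists_represents (E s)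
    have hzr := (hu.sub he.left).mul (he.right.sub hu)
    have hzp : ∀ m : ℕ, Represents (fun ε => ((u ε - α ε) * (β ε - u ε)) ^ m) (z s ^ m) := by
      intro m
      induction m with
      | zero => simpa using Represents.one
      | succ m ih => simpa only [pow_succ] using ih.mul hzr
    refine RC.le_of_eventually_le Represents.zero (hEe.mul ((hzp m).mul hEe))
      (Eventually.of_forall fun ε => ?_)
    have h1 : 0 ≤ (u ε - α ε) * (β ε - u ε) :=
      mul_nonneg (by linarith [(hum ε).1]) (by linarith [(hum ε).2])
    calc 0 ≤ ((u ε - α ε) * (β ε - u ε)) ^ m * (e ε * e ε) :=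
          mul_nonneg (pow_nonneg h1 m) (mul_self_nonneg _)
      _ = _ := by ring
  refine hE.eq_zero_of_frequently hab ht fun n => ?_
  obtain ⟨s, -, h1, h2, h3, h4⟩ := he.exists_increment ht n
  refine ⟨s, h1, h2, RC.eq_zero_of_mul_self ?_⟩
  have h5 : IsUnit (z (t + s) ^ m) := (h3.mul h4).pow m
  refine h5.mul_left_cancel ?_
  rw [mul_zero, ← key _ h2]
  ring

end Iterated

/-! ### The first variation -/

section Variation

variable {d m : ℕ} {a b t : RC ρ} {q h : RC ρ → Fin d → RC ρ}
  {L : (Option (Fin (m + 1) × Fin d) → RC ρ) → RC ρ}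
  {Ω : Idx → Set (Option (Fin (m + 1) × Fin d) → ℝ)}
  {Φ : Idx → (Option (Fin (m + 1) × Fin d) → ℝ) → ℝ}
  {g : Option (Fin (m + 1) × Fin d) → (Option (Fin (m + 1) × Fin d) → RC ρ) → RC ρ}

/-- The derivative `(0, h(t), h'(t), …, h^(m)(t))` of the jet of `q + s h` with respect to `s`. -/
noncomputable def jetVariation (m : ℕ) (a b : RC ρ) (h : RC ρ → Fin d → RC ρ) (t : RC ρ) :
    Option (Fin (m + 1) × Fin d) → RC ρ
  | none => 0
  | some (i, k) => iterDeriv (RC.interval a b) i (fun s => h s k) t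

lemma IsGSFCurve.isGSF₁_jet (hq : IsGSFCurve a b q) (hab : RC.Lt a b)
    (j : Option (Fin (m + 1) × Fin d)) :
    IsGSF₁ (RC.interval a b) fun t => jet m a b q t j := by
  match j with
  | none => exact isGSF₁_id
  | some (i, k) => exact (hq k).iterDeriv_interval hab i

lemma IsGSFCurve.isGSF₁_jetVariation (hh : IsGSFCurve a b h) (hab : RC.Lt a b)
    (j : Option (Fin (m + 1) × Fin d)) :
    IsGSF₁ (RC.interval a b) fun t => jetVariation m a b h t j := by
  match j with
  | none => exact isGSF₁_const 0
  | some (i, k) => exact (hh k).iterDeriv_interval hab i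

lemma IsGSFCurve.add_mul (hq : IsGSFCurve a b q) (hh : IsGSFCurve a b h) (s : RC ρ) :
    IsGSFCurve a b fun t k => q t k + s * h t k :=
  fun k => (hq k).add ((isGSF₁_const s).mul (hh k))

lemma jet_add_mul (hq : IsGSFCurve a b q) (hh : IsGSFCurve a b h) (hab : RC.Lt a b) (s : RC ρ)
    (ht : t ∈ RC.interval a b) (j : Option (Fin (m + 1) × Fin d)) :
    jet m a b (fun t k => q t k + s * h t k) t j =
      jet m a b q t j + s * jetVariation m a b h t j := by
  match j with
  | none => simp [jet, jetVariation]
  | some (i, k) =>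
    simp only [jet, jetVariation]
    rw [iterDeriv_add hab (hq k) ((isGSF₁_const s).mul (hh k)) i ht,
      iterDeriv_const_mul hab s (hh k) i ht]

lemma IsGSF.comp_jet (hL : IsGSF (slab none a b) L) (hq : IsGSFCurve a b q) (hab : RC.Lt a b) :
    IsGSF₁ (RC.interval a b) fun t => L (jet m a b q t) :=
  hL.comp_isGSF₁ (fun j => hq.isGSF₁_jet hab j) fun _ ht => ht

/-- A finite family of generalized smooth functions on `[a,b]` has a common bound. -/
lemma exists_boundedBy_family {ι : Type*} [Fintype ι] {F : RC ρ → ι → RC ρ}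
    (hF : ∀ i, IsGSF₁ (RC.interval a b) fun t => F t i) (hab : RC.Lt a b) :
    ∃ K, ∀ t ∈ RC.interval a b, ∀ i, RC.BoundedBy K (F t i) := by
  choose K hK using fun i => (hF i).exists_boundedBy hab
  exact ⟨∑ i, K i, fun t ht i => (hK i t ht).mono
    (Finset.single_le_sum (fun _ _ => Nat.zero_le _) (Finset.mem_univ i))⟩

lemma RC.BoundedBy.mul_of_lt {K : ℕ} {s x : RC ρ} (hx : RC.BoundedBy K x)
    (hs : RC.Lt (RC.abs s) (RC.gaugePow ρ 0)) : RC.BoundedBy K (s * x) := by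
  obtain ⟨u, hu, hb⟩ := hx
  obtain ⟨S, hS⟩ := exists_represents s
  obtain ⟨J, hJ⟩ := (RC.lt_iff hS.abs (RC.represents_gaugePow 0)).1 hs
  refine ⟨_, hS.mul hu, ?_⟩
  filter_upwards [hb, hJ] with ε h1 h2
  have := ρ.pow_pos J ε
  rw [pow_zero] at h2
  rw [abs_mul]
  exact (mul_le_of_le_one_left (abs_nonneg _) (by linarith)).trans h1

/-- The Taylor estimate for the Lagrangian, along the jets of the curves `q + s h`, is uniform
in the time. -/
lemma HasNet.exists_taylor_jet (hL : HasNet (slab none a b) L Ω Φ)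
    (hg : ∀ j, HasNet (slab none a b) (g j) Ω fun ε w => fderiv ℝ (Φ ε) w (Pi.single j 1))
    (hq : IsGSFCurve a b q) (hh : IsGSFCurve a b h) (hab : RC.Lt a b) :
    ∃ C : RC ρ, ∀ s, RC.Lt (RC.abs s) (RC.gaugePow ρ 0) → ∀ t ∈ RC.interval a b,
      RC.Le (RC.abs (L (jet m a b (fun t k => q t k + s * h t k) t) - L (jet m a b q t) -
        s * ∑ j, g j (jet m a b q t) * jetVariation m a b h t j)) (C * (s * s)) := by
  obtain ⟨K₁, hK₁⟩ := exists_boundedBy_family (fun j => hq.isGSF₁_jet (m := m) hab j) hab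
  obtain ⟨K₂, hK₂⟩ := exists_boundedBy_family (fun j => hh.isGSF₁_jetVariation (m := m) hab j) hab
  let K := K₁ + K₂
  obtain ⟨N, C, hC, hT⟩ := hL.exists_taylor hg hab (K + 1)
  -- The constant also absorbs the sum of the squares of the coordinates of the variation.
  let c : Idx → ℝ := fun ε => (ρ ε ^ N)⁻¹ *
    (Fintype.card (Option (Fin (m + 1) × Fin d)) * ((ρ ε ^ (K₂ + 1))⁻¹ * (ρ ε ^ (K₂ + 1))⁻¹))
  have hc : IsModerate ρ c := (isModerate_inv_pow N).mul ((isModerate_const _).mul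
    ((isModerate_inv_pow _).mul (isModerate_inv_pow _)))
  obtain ⟨C', hC'⟩ := hc.exists_represents
  refine ⟨C', fun s hs t ht => ?_⟩
  have h1 := hT (jet m a b q t) ht (jet m a b (fun t k => q t k + s * h t k) t) ht
    (fun j => (hK₁ t ht j).mono (by omega)) fun j => by
      rw [jet_add_mul hq hh hab s ht]
      exact ((hK₁ t ht j).mono (by omega : K₁ ≤ K)).add
        (((hK₂ t ht j).mono (by omega : K₂ ≤ K)).mul_of_lt hs)
  have e : ∀ j, jet m a b (fun t k => q t k + s * h t k) t j - jet m a b q t j =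
      s * jetVariation m a b h t j := fun j => by
    rw [jet_add_mul hq hh hab s ht, add_sub_cancel_left]
  simp only [e] at h1
  have e2 : s * ∑ j, g j (jet m a b q t) * jetVariation m a b h t j =
      ∑ j, g j (jet m a b q t) * (s * jetVariation m a b h t j) := by
    rw [Finset.mul_sum]
    exact Finset.sum_congr rfl fun j _ => by ring
  rw [e2]
  obtain ⟨D, hD⟩ := exists_represents (RC.abs (L (jet m a b (fun t k => q t k + s * h t k) t) -
    L (jet m a b q t) - ∑ j, g j (jet m a b q t) * (s * jetVariation m a b h t j)))
  obtain ⟨S, hS⟩ := exists_represents s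
  obtain ⟨v, hv⟩ := exists_representsPt (jetVariation m a b h t)
  have h2 := (RC.le_iff hD (hC.mul (Represents.sum _ fun j _ =>
    (hS.mul (hv j)).mul (hS.mul (hv j))))).1 h1
  refine (RC.le_iff hD (hC'.mul (hS.mul hS))).2 fun n => ?_
  filter_upwards [h2 n, eventually_all.2 fun j => (hK₂ t ht j).eventually_le (hv j)] with ε h3 h4
  refine h3.trans (add_le_add_left ?_ _)
  simp only [c, mul_assoc]
  refine mul_le_mul_of_nonneg_left ?_ (inv_nonneg.2 (ρ.pow_pos N ε).le)
  rw [← nsmul_eq_mul, ← Finset.card_univ]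
  refine Finset.sum_le_card_nsmul _ _ _ fun j _ => ?_
  have h5 : v ε j * v ε j ≤ (ρ ε ^ (K₂ + 1))⁻¹ * (ρ ε ^ (K₂ + 1))⁻¹ := by
    rw [← abs_mul_abs_self]
    exact mul_le_mul (h4 j) (h4 j) (abs_nonneg _) (inv_nonneg.2 (ρ.pow_pos _ ε).le)
  calc S ε * (v ε j * (S ε * v ε j)) = (v ε j * v ε j) * (S ε * S ε) := by ring
    _ ≤ (ρ ε ^ (K₂ + 1))⁻¹ * (ρ ε ^ (K₂ + 1))⁻¹ * (S ε * S ε) :=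
      mul_le_mul_of_nonneg_right h5 (mul_self_nonneg _)
    _ = _ := mul_assoc _ _ _

/-- The first variation is the integral of the first order part of the Taylor expansion of the
Lagrangian. -/
lemma HasNet.firstVariation_eq (hL : HasNet (slab none a b) L Ω Φ)
    (hg : ∀ j, HasNet (slab none a b) (g j) Ω fun ε w => fderiv ℝ (Φ ε) w (Pi.single j 1))
    (hq : IsGSFCurve a b q) (hh : IsGSFCurve a b h) (hab : RC.Lt a b) :
    firstVariation a b L q h = primitive a b a
      (fun t => ∑ j, g j (jet m a b q t) * jetVariation m a b h t j) b := by
  obtain ⟨α, β, he⟩ := exists_isEndpoints hab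
  have hψ : IsGSF₁ (RC.interval a b)
      fun t => ∑ j, g j (jet m a b q t) * jetVariation m a b h t j :=
    IsGSF₁.sum _ fun j _ => ((hg j).isGSF.comp_jet hq hab).mul (hh.isGSF₁_jetVariation hab j)
  have hP := hψ.isPrimitive_primitive hab
  have hA : ∀ s, IsPrimitive a b a (fun t => L (jet m a b (fun t k => q t k + s * h t k) t))
      (primitive a b a fun t => L (jet m a b (fun t k => q t k + s * h t k) t)) := fun s =>
    (hL.isGSF.comp_jet (hq.add_mul hh s) hab).isPrimitive_primitive hab
  have hA0 : IsPrimitive a b a (fun t => L (jet m a b q t))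
      (primitive a b a fun t => L (jet m a b q t)) :=
    (hL.isGSF.comp_jet hq hab).isPrimitive_primitive hab
  obtain ⟨C, hC⟩ := hL.exists_taylor_jet hg hq hh hab
  have key : HasDirDeriv Set.univ (fun s : RC ρ => action a b L (fun t k => q t k + s * h t k))
      0 1 (primitive a b a
        (fun t => ∑ j, g j (jet m a b q t) * jetVariation m a b h t j) b) := by
    refine HasDirDeriv.of_quadratic (C := C * (b - a)) (RC.gaugePow_pos 0) fun s hs _ => ?_
    have hAs := hA s
    simp only [smul_eq_mul, mul_one, zero_add, zero_mul, add_zero, action]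
    set A := primitive a b a fun t => L (jet m a b (fun t k => q t k + s * h t k) t)
    set A0 := primitive a b a fun t => L (jet m a b q t)
    set P := primitive a b a
      (fun t => ∑ j, g j (jet m a b q t) * jetVariation m a b h t j)
    have hsP : IsGSF₁ (RC.interval a b) fun t => s * P t := (isGSF₁_const s).mul hP.1
    have hG : IsGSF₁ (RC.interval a b) fun t => A t - A0 t - s * P t :=
      (hAs.1.sub hA0.1).sub hsP
    have hD : ∀ t ∈ RC.interval a b,
        dirDeriv (RC.interval a b) (fun t => A t - A0 t - s * P t) 1 t =
          L (jet m a b (fun t k => q t k + s * h t k) t) - L (jet m a b q t) -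
            s * ∑ j, g j (jet m a b q t) * jetVariation m a b h t j := fun t ht => by
      rw [dirDeriv_sub hab ht (hAs.1.sub hA0.1) hsP, dirDeriv_sub hab ht hAs.1 hA0.1,
        dirDeriv_const_mul hab ht s hP.1, (hAs.2.2 t ht).dirDeriv_eq hab ht,
        (hA0.2.2 t ht).dirDeriv_eq hab ht, (hP.2.2 t ht).dirDeriv_eq hab ht]
    have e0 : A a - A0 a - s * P a = 0 := by
      rw [hAs.2.1, hA0.2.1, hP.2.1]; ring
    have hlow := hG.mul_sub_le hab (κ := -(C * (s * s)))
      (fun t ht => by rw [hD t ht]; exact (RC.abs_le_iff.1 (hC s hs t ht)).1)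
      he.left_mem he.right_mem he.left_mem.2
    have hupp := ((isGSF₁_const (-1)).mul hG).mul_sub_le hab (κ := -(C * (s * s)))
      (fun t ht => by
        rw [dirDeriv_const_mul hab ht (-1) hG, hD t ht, neg_one_mul]
        exact RC.neg_le_neg (RC.abs_le_iff.1 (hC s hs t ht)).2)
      he.left_mem he.right_mem he.left_mem.2
    simp only [e0] at hlow hupp
    refine RC.abs_le_iff.2 ⟨?_, ?_⟩
    · convert hlow using 1 <;> ring
    · have := RC.neg_le_neg hupp
      convert this using 1 <;> ring
  refine HasDirDeriv.unique (fun n => ?_) key.hasDirDeriv_dirDeriv key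
  obtain ⟨s, h1, h2⟩ := RC.exists_isUnit_lt_gaugePow (ρ := ρ) n
  exact ⟨s, h1, h2, Set.mem_univ _⟩

/-! ### The Euler–Lagrange equations -/

lemma HasNet.hasDirDeriv_partialL (hL : HasNet (slab none a b) L Ω Φ)
    (hg : ∀ j, HasNet (slab none a b) (g j) Ω fun ε w => fderiv ℝ (Φ ε) w (Pi.single j 1))
    (hab : RC.Lt a b) (i : Fin (m + 1)) (k : Fin d) (ht : t ∈ RC.interval a b) :
    HasDirDeriv (slab none a b) L (jet m a b q t) (Pi.single (some (i, k)) 1)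
        (partialL a b L q i k t) ∧
      partialL a b L q i k t = g (some (i, k)) (jet m a b q t) := by
  have h1 := hL.hasDirDeriv_single hg hab (x := jet m a b q t) ht (some (i, k))
  have h2 : HasDirDeriv (slab none a b) L (jet m a b q t) (Pi.single (some (i, k)) 1)
      (partialL a b L q i k t) := h1.hasDirDeriv_dirDeriv
  refine ⟨h2, h2.unique (fun n => ?_) h1⟩
  obtain ⟨s, hs1, hs2⟩ := RC.exists_isUnit_lt_gaugePow (ρ := ρ) n
  refine ⟨s, hs1, hs2, ?_⟩
  simpa [slab, jet] using ht

lemma isGSF₁_partialL (hL : IsGSF (slab none a b) L) (hq : IsGSFCurve a b q) (hab : RC.Lt a b)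
    (i : Fin (m + 1)) (k : Fin d) : IsGSF₁ (RC.interval a b) (partialL a b L q i k) := by
  obtain ⟨Ω, Φ, hL⟩ := isGSF_iff_exists_hasNet.1 hL
  obtain ⟨g, hg⟩ := hL.exists_partial
  exact ((hg (some (i, k))).isGSF.comp_jet hq hab).congr fun t ht =>
    (hL.hasDirDeriv_partialL hg hab i k ht).2.symm

/-- The integral of the Euler–Lagrange expression against an admissible variation of one component
of the curve vanishes. -/
lemma IsWeakExtremal.integral_eq_zero (hL : IsGSF (slab none a b) L) (hab : RC.Lt a b)
    (hq : IsWeakExtremal a b L q) (k : Fin d) {η : RC ρ → RC ρ}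
    (hη : IsGSF₁ (RC.interval a b) η)
    (h0 : ∀ i < m, iterDeriv (RC.interval a b) i η a = 0 ∧
      iterDeriv (RC.interval a b) i η b = 0) :
    primitive a b a (fun t => (∑ i : Fin (m + 1), (-1) ^ (i : ℕ) *
      iterDeriv (RC.interval a b) i (partialL a b L q i k) t) * η t) b = 0 := by
  obtain ⟨α, β, he⟩ := exists_isEndpoints hab
  have hφ := isGSF₁_partialL hL hq.1 hab
  obtain ⟨Ω, Φ, hLn⟩ := isGSF_iff_exists_hasNet.1 hL
  obtain ⟨g, hg⟩ := hLn.exists_partial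
  let h : RC ρ → Fin d → RC ρ := fun t k' => if k' = k then η t else 0
  have hk : ∀ k', k' ≠ k → (fun t => h t k') = fun _ => 0 := fun k' hk' => by
    funext t; simp [h, hk']
  have hk0 : (fun t => h t k) = η := by funext t; simp [h]
  have hzero : ∀ (i : ℕ), ∀ t ∈ RC.interval a b,
      iterDeriv (RC.interval a b) i (fun _ => 0) t = 0 := fun i t ht => by
    simpa using iterDeriv_const_mul hab 0 (isGSF₁_const (0 : RC ρ)) i ht
  have hh : IsGSFCurve a b h := fun k' => by
    by_cases hk' : k' = k
    · subst hk'; rw [hk0]; exact hη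
    · rw [hk k' hk']; exact isGSF₁_const 0
  have hvar : IsVariation m a b h := ⟨hh, fun i hi k' => by
    by_cases hk' : k' = k
    · subst hk'; rw [hk0]; exact h0 i hi
    · rw [hk k' hk']; exact ⟨hzero i a he.left_mem, hzero i b he.right_mem⟩⟩
  have h1 := hq.2 h hvar
  rw [hLn.firstVariation_eq hg hq.1 hh hab] at h1
  have hψ : IsGSF₁ (RC.interval a b)
      fun t => ∑ j, g j (jet m a b q t) * jetVariation m a b h t j :=
    IsGSF₁.sum _ fun j _ => ((hg j).isGSF.comp_jet hq.1 hab).mul (hh.isGSF₁_jetVariation hab j)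
  have hsum : ∀ t ∈ RC.interval a b, ∑ j, g j (jet m a b q t) * jetVariation m a b h t j =
      ∑ i : Fin (m + 1), partialL a b L q i k t * iterDeriv (RC.interval a b) i η t := by
    intro t ht
    rw [Fintype.sum_option, Fintype.sum_prod_type]
    simp only [jetVariation, mul_zero, zero_add]
    refine Finset.sum_congr rfl fun i _ => ?_
    rw [Finset.sum_eq_single k (fun k' _ hk' => by rw [hk k' hk', hzero i t ht, mul_zero])
      (by simp), hk0, (hLn.hasDirDeriv_partialL hg hab i k ht).2]
  choose B hB hBa hBb hBD using fun i : Fin (m + 1) =>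
    exists_primitive_by_parts hab (hφ i k) hη i fun j hj => h0 j (by omega)
  have hE : IsGSF₁ (RC.interval a b) fun t => (∑ i : Fin (m + 1), (-1) ^ (i : ℕ) *
      iterDeriv (RC.interval a b) i (partialL a b L q i k) t) * η t :=
    (IsGSF₁.sum _ fun i _ => (isGSF₁_const _).mul ((hφ i k).iterDeriv_interval hab i)).mul hη
  have hP := hE.isPrimitive_primitive hab
  have hSB : IsGSF₁ (RC.interval a b) fun t => ∑ i, B i t := IsGSF₁.sum _ fun i _ => hB i
  have hQ : IsPrimitive a b a
      (fun t => ∑ i : Fin (m + 1), partialL a b L q i k t * iterDeriv (RC.interval a b) i η t)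
      (fun t => ∑ i, B i t + primitive a b a (fun t => (∑ i : Fin (m + 1), (-1) ^ (i : ℕ) *
        iterDeriv (RC.interval a b) i (partialL a b L q i k) t) * η t) t) := by
    refine ⟨hSB.add hP.1, by simp [hBa, hP.2.1], fun t ht => ?_⟩
    have h2 := (hSB.add hP.1).hasDirDeriv hab ht
    rw [dirDeriv_add hab ht hSB hP.1, (hP.2.2 t ht).dirDeriv_eq hab ht,
      dirDeriv_sum hab ht _ fun i _ => hB i] at h2
    beta_reduce at h2
    rw [Finset.sum_mul, ← Finset.sum_add_distrib] at h2
    convert h2 using 1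
    refine Finset.sum_congr rfl fun i _ => ?_
    rw [hBD i t ht]
    ring
  have h3 := (hψ.isPrimitive_primitive hab).eqOn hQ hab hsum he.right_mem
  rw [h1] at h3
  simpa [hBb] using h3.symm

/-- The differential form of the Euler–Lagrange equations. -/
lemma IsWeakExtremal.eulerLagrange (hL : IsGSF (slab none a b) L) (hab : RC.Lt a b)
    (hq : IsWeakExtremal a b L q) (k : Fin d) (ht : t ∈ RC.interval a b) :
    ∑ i : Fin (m + 1), (-1) ^ (i : ℕ) *
      iterDeriv (RC.interval a b) (i : ℕ) (partialL a b L q i k) t = 0 :=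
  IsGSF₁.eq_zero_of_forall_integral_mul_eq_zero
    (E := fun t => ∑ i : Fin (m + 1), (-1) ^ (i : ℕ) *
      iterDeriv (RC.interval a b) (i : ℕ) (partialL a b L q i k) t)
    (IsGSF₁.sum _ fun i _ => (isGSF₁_const _).mul
      ((isGSF₁_partialL hL hq.1 hab i k).iterDeriv_interval hab i)) hab m
    (fun _ hη h0 => hq.integral_eq_zero hL hab k hη h0) ht

/-- The integral form of the Euler–Lagrange equations: the derivative of order `m` of the sum of
iterated integrals is the Euler–Lagrange expression. -/
lemma IsWeakExtremal.exists_polynomial (hL : IsGSF (slab none a b) L) (hab : RC.Lt a b)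
    (hm : 0 < m) (hq : IsWeakExtremal a b L q) (k : Fin d) :
    ∃ p : Polynomial (RC ρ), p.natDegree ≤ m - 1 ∧ ∀ t ∈ RC.interval a b,
      ∑ i : Fin (m + 1), (-1) ^ (i : ℕ) *
        iterInt a b (m - (i : ℕ)) (partialL a b L q i k) t = p.eval t := by
  have hI := fun i : Fin (m + 1) =>
    (isGSF₁_partialL hL hq.1 hab i k).iterInt_interval hab (m - (i : ℕ))
  have hS := fun i : Fin (m + 1) => (isGSF₁_const ((-1) ^ (i : ℕ))).mul (hI i)
  refine IsGSF₁.exists_polynomial hab (IsGSF₁.sum _ fun i _ => hS i) (m - 1) fun t ht => ?_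
  rw [Nat.sub_add_cancel hm, iterDeriv_sum hab _ (fun i _ => hS i) m ht,
    ← hq.eulerLagrange hL hab k ht]
  refine Finset.sum_congr rfl fun i _ => ?_
  rw [iterDeriv_const_mul hab _ (hI i) m ht,
    ← iterDeriv_add_iterInt (isGSF₁_partialL hL hq.1 hab i k) hab i (m - (i : ℕ)) ht,
    Nat.add_sub_cancel' (by omega)]

end Variation

end RobinsonColombeau

theorem mainTheorem1 (ρ : Gauge) (d m : ℕ) (hm : 0 < m) (t₁ t₂ : RC ρ) (ht : RC.Lt t₁ t₂)
    (L : (Option (Fin (m + 1) × Fin d) → RC ρ) → RC ρ)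
    (hL : IsGSF (lagrangianDomain d m t₁ t₂) L)
    (q : RC ρ → Fin d → RC ρ) (hq : IsWeakExtremal t₁ t₂ L q) :
    -- all derivatives and iterated integrals in the two equations below exist
    (∀ (k : Fin d) (n : ℕ), ∀ t ∈ RC.interval t₁ t₂,
      HasDirDeriv (RC.interval t₁ t₂)
        (iterDeriv (RC.interval t₁ t₂) n (fun s => q s k)) t 1
        (iterDeriv (RC.interval t₁ t₂) (n + 1) (fun s => q s k) t)) ∧
    (∀ (i : Fin (m + 1)) (k : Fin d), ∀ t ∈ RC.interval t₁ t₂,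
      HasDirDeriv (lagrangianDomain d m t₁ t₂) L (jet m t₁ t₂ q t) (Pi.single (some (i, k)) 1)
        (partialL t₁ t₂ L q i k t)) ∧
    (∀ (i : Fin (m + 1)) (k : Fin d) (n : ℕ), ∀ t ∈ RC.interval t₁ t₂,
      HasDirDeriv (RC.interval t₁ t₂)
        (iterDeriv (RC.interval t₁ t₂) n (partialL t₁ t₂ L q i k)) t 1
        (iterDeriv (RC.interval t₁ t₂) (n + 1) (partialL t₁ t₂ L q i k) t)) ∧
    (∀ (i : Fin (m + 1)) (k : Fin d) (n : ℕ),
      IsPrimitive t₁ t₂ t₁ (iterInt t₁ t₂ n (partialL t₁ t₂ L q i k))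
        (iterInt t₁ t₂ (n + 1) (partialL t₁ t₂ L q i k))) ∧
    -- integral form
    (∀ k : Fin d, ∃ p : Polynomial (RC ρ), p.natDegree ≤ m - 1 ∧
      ∀ t ∈ RC.interval t₁ t₂,
        ∑ i : Fin (m + 1), (-1) ^ (i : ℕ) *
          iterInt t₁ t₂ (m - (i : ℕ)) (partialL t₁ t₂ L q i k) t = p.eval t) ∧
    -- differential form
    (∀ k : Fin d, ∀ t ∈ RC.interval t₁ t₂,
      ∑ i : Fin (m + 1), (-1) ^ (i : ℕ) *
        iterDeriv (RC.interval t₁ t₂) (i : ℕ) (partialL t₁ t₂ L q i k) t = 0) := by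
  have hL' : IsGSF (slab none t₁ t₂) L := hL
  refine ⟨fun k n t h => ?_, fun i k t h => ?_, fun i k n t h => ?_, fun i k n => ?_,
    fun k => hq.exists_polynomial hL' ht hm k, fun k t h => hq.eulerLagrange hL' ht k h⟩
  · rw [iterDeriv_succ]
    exact ((hq.1 k).iterDeriv_interval ht n).hasDirDeriv ht h
  · obtain ⟨Ω, Φ, hLn⟩ := isGSF_iff_exists_hasNet.1 hL'
    obtain ⟨g, hg⟩ := hLn.exists_partial
    exact (hLn.hasDirDeriv_partialL hg ht i k h).1
  · rw [iterDeriv_succ]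
    exact ((isGSF₁_partialL hL' hq.1 ht i k).iterDeriv_interval ht n).hasDirDeriv ht h
  · exact (isGSF₁_partialL hL' hq.1 ht i k).isPrimitive_iterInt ht n
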